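/- Let $M$ be a locally compact, second countable Hausdorff space (for instance a geodesically complete connected oriented non-compact Riemannian $C^\infty$-manifold), with Borel $\sigma$-algebra $\mathcal B(M)$, let $\mu$ be a non-atomic Radon measure on $M$, and let $0<\alpha<1$. Let $E_\alpha(z)=\sum_{n\ge 0} z^n/\Gamma(\alpha n+1)$ be the Mittag-Leffler function. Let $\Gamma$ be the space of all locally finite subsets of $M$, with the Borel $\sigma$-algebra of the vague topology (the weakest topology making $\gamma\mapsto\sum_{x\in\gamma}f(x)$ continuous for all real continuous $f$ with compact support), and let $\Gamma_0=\bigsqcup_{n\ge 0}\Gamma_M^{(n)}$ be the space of finite subsets of $M$, where the set $\Gamma_M^{(n)}$ of $n$-point subsets carries the quotient topology under $\mathrm{sym}^n:(x_1,\dots,x_n)\mapsto\{x_1,\dots,x_n\}$ (defined on $n$-tuples of pairwise distinct points), $\Gamma_0$ carries the disjoint union topology, and the corresponding Borel $\sigma$-algebra is taken. Write $\mathcal B_c(M)$ for the Borel sets with compact closure. For a Borel set $Y$ let $\mu_Y^{(n)}$ be the image under $\mathrm{sym}^n$ of the restriction of $\mu^{\otimes n}$ to the $n$-tuples of pairwise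 distinct points of $Y$, with $\mu_Y^{(0)}=\delta_\emptyset$, and put $\mu^{(n)}=\mu_M^{(n)}$. There is exactly one measure $\pi_\mu^\alpha$ on $\Gamma$, the fractional Poisson measure, whose image under $\gamma\mapsto\gamma\cap\Lambda$ is $$\pi_{\mu,\Lambda}^\alpha=\sum_{n=0}^\infty\frac{E_\alpha^{(n)}(-\mu(\Lambda))}{n!}\,\mu_\Lambda^{(n)}$$ for every $\Lambda\in\mathcal B_c(M)$; it is a probability measure, and it has finite local moments of all orders, i.e. $\int_\Gamma|\gamma\cap\Lambda|^n\,d\pi_\mu^\alpha(\gamma)<\infty$ for all $n\in\mathbb N$ and $\Lambda\in\mathcal B_c(M)$. Its correlation measure $K^*\pi_\mu^\alpha$, that is, the unique measure on $\Gamma_0$ with $$(K^*\pi_\mu^\alpha)(A)=\int_\Gamma\sum_{\eta\subset\gamma,\ |\eta|<\infty}\mathbf 1_A(\eta)\,d\pi_\mu^\alpha(\gamma)$$ for all bounded measurable $A\subset\Gamma_0$ (bounded: for some $N\in\mathbb N_0$ and $\Lambda\in\mathcal B_c(M)$, every $\eta\in A$ satisfies $|\eta|\le N$ and $\eta\subset\Lambda$),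 exists and is equal to the fractional Lebesgue–Poisson measure $$\lambda_\mu^\alpha:=\sum_{n=0}^\infty\frac{1}{\Gamma(\alpha n+1)}\,\mu^{(n)} .$$ In other words, $d\lambda_\mu^\alpha=E_\alpha^{(|\cdot|)}(0)\,d\lambda_\mu$, where $\lambda_\mu:=\sum_{n=0}^\infty\frac1{n!}\mu^{(n)}$ is the Lebesgue–Poisson measure and $|\eta|$ is the number of points of $\eta$. -/

import Mathlib

open MeasureTheory
open scoped ENNReal Nat CompactlySupported

noncomputable section

namespace FracPoisson

/-- The Mittag-Leffler function `E_α(x) = ∑ xⁿ / Γ(α n + 1)` on the real line. -/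
def mittagLeffler (α x : ℝ) : ℝ :=
  ∑' n : ℕ, x ^ n / Real.Gamma (α * n + 1)

section Spaces

variable (M : Type*)

/-- The configuration space `Γ`: all subsets of `M` having finitely many points in each
compact set. -/
def Config [TopologicalSpace M] : Type _ :=
  {γ : Set M // ∀ K : Set M, IsCompact K → (γ ∩ K).Finite}

/-- The space `Γ₀` of finite configurations: all finite subsets of `M`. -/
def FinConfig : Type _ := Finset M

end Spaces

variable {M : Type*}

/-- The underlying set of a configuration. -/
def Config.points [TopologicalSpace M] (γ : Config M) : Set M := γ.1

/-- The underlying finite set of a finite configuration. -/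
def FinConfig.points (η : FinConfig M) : Finset M := η

/-- The number of points `|η|` of a finite configuration. -/
def FinConfig.card (η : FinConfig M) : ℕ := η.points.card

/-- The pairing `⟨γ, f⟩ = ∑_{x ∈ γ} f(x)`; for compactly supported `f` only finitely many terms
are nonzero. -/
def Config.pairing [TopologicalSpace M] (γ : Config M) (f : C_c(M, ℝ)) : ℝ :=
  ∑ᶠ x ∈ γ.points, f x

/-- The vague topology on `Γ`: the weakest topology making all `γ ↦ ⟨γ, f⟩` continuous, where `f`
runs over the real continuous functions with compact support. -/
instance Config.instTopologicalSpace [TopologicalSpace M] : TopologicalSpace (Config M) :=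
  ⨅ f : C_c(M, ℝ), TopologicalSpace.induced (fun γ : Config M => γ.pairing f) inferInstance

/-- `Γ` carries the Borel σ-algebra of the vague topology. -/
instance Config.instMeasurableSpace [TopologicalSpace M] : MeasurableSpace (Config M) :=
  borel (Config M)

/-- The set of `n`-tuples of pairwise distinct points of `M`. -/
abbrev DistinctTuple (M : Type*) (n : ℕ) : Type _ :=
  {x : Fin n → M // Function.Injective x}

/-- The map `(x₁, …, xₙ) ↦ {x₁, …, xₙ}` on tuples of pairwise distinct points. -/
def sym (n : ℕ) (x : DistinctTuple M n) : FinConfig M :=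
  (Finset.univ.map ⟨x.1, x.2⟩ : Finset M)

/-- The topology of `Γ₀` as the disjoint union over `n` of the spaces of `n`-point configurations,
each carrying the quotient topology under `sym n`: a set is open iff its preimage under every
`sym n` is open. -/
instance FinConfig.instTopologicalSpace [TopologicalSpace M] : TopologicalSpace (FinConfig M) :=
  ⨆ n : ℕ, TopologicalSpace.coinduced (sym (M := M) n) inferInstance

/-- `Γ₀` carries its Borel σ-algebra. -/
instance FinConfig.instMeasurableSpace [TopologicalSpace M] : MeasurableSpace (FinConfig M) :=
  borel (FinConfig M)

/-- The image `μ⁽ⁿ⁾ = μ^{⊗n} ∘ (symⁿ)⁻¹` on `Γ₀` of the product measure (restricted to tuples of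
pairwise distinct points); it is concentrated on the `n`-point configurations. For `n = 0` it is
the unit mass at the empty configuration. -/
def pointMeasure [TopologicalSpace M] [MeasurableSpace M] (μ : Measure M) (n : ℕ) :
    Measure (FinConfig M) :=
  ((Measure.pi fun _ : Fin n => μ).comap
    (Subtype.val : DistinctTuple M n → (Fin n → M))).map (sym n)

/-- Borel sets with compact closure. -/
structure IsBoundedBorel [TopologicalSpace M] [MeasurableSpace M] (Λ : Set M) : Prop where
  measurableSet : MeasurableSet Λ
  isCompact_closure : IsCompact (closure Λ)

/-- The projection `γ ↦ γ ∩ Λ`, for `Λ` with compact closure. The configurations contained in `Λ`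
are regarded as elements of `Γ₀`. -/
def proj [TopologicalSpace M] (Λ : Set M) (hΛ : IsCompact (closure Λ)) (γ : Config M) :
    FinConfig M :=
  ((γ.2 (closure Λ) hΛ).subset (Set.inter_subset_inter_right γ.1 subset_closure)).toFinset

/-- The local fractional Poisson measure
`π_{μ,Λ}^α = ∑ₙ (E_α⁽ⁿ⁾(-μ(Λ)) / n!) μ_Λ⁽ⁿ⁾`, where `μ_Λ⁽ⁿ⁾` is formed from the restriction of
`μ` to `Λ`, as a measure on `Γ₀` concentrated on the configurations contained in `Λ`. -/
def localFracPoisson [TopologicalSpace M] [MeasurableSpace M] (α : ℝ) (μ : Measure M)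
    (Λ : Set M) : Measure (FinConfig M) :=
  Measure.sum fun n : ℕ =>
    ENNReal.ofReal (iteratedDeriv n (mittagLeffler α) (-(μ Λ).toReal) / (n ! : ℝ)) •
      pointMeasure (μ.restrict Λ) n

/-- `π` is the fractional Poisson measure on `Γ`: its image under `γ ↦ γ ∩ Λ` is the local
fractional Poisson measure, for every Borel set `Λ` with compact closure. -/
def IsFracPoisson [TopologicalSpace M] [MeasurableSpace M] (α : ℝ) (μ : Measure M)
    (π : Measure (Config M)) : Prop :=
  ∀ (Λ : Set M) (hΛ : IsBoundedBorel Λ),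
    π.map (proj Λ hΛ.isCompact_closure) = localFracPoisson α μ Λ

/-- The `K`-transform `(KG)(γ) = ∑_{η ⊆ γ, |η| < ∞} G(η)`; for `G` with local support only finitely
many terms are nonzero. -/
def kTransform [TopologicalSpace M] (G : FinConfig M → ℝ) (γ : Config M) : ℝ :=
  ∑ᶠ η ∈ {η : FinConfig M | (η.points : Set M) ⊆ γ.points}, G η

/-- Bounded subsets of `Γ₀`: the number of points is bounded and all points lie in a fixed Borel
set with compact closure. -/
def IsBoundedConfigSet [TopologicalSpace M] [MeasurableSpace M] (A : Set (FinConfig M)) : Prop :=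
  ∃ (N : ℕ) (Λ : Set M), IsBoundedBorel Λ ∧
    ∀ η ∈ A, η.card ≤ N ∧ (η.points : Set M) ⊆ Λ

/-- Finite local moments of all orders. -/
def HasFiniteLocalMoments [TopologicalSpace M] [MeasurableSpace M]
    (ν : Measure (Config M)) : Prop :=
  ∀ (n : ℕ) (Λ : Set M) (hΛ : IsBoundedBorel Λ),
    ∫⁻ γ, ((proj Λ hΛ.isCompact_closure γ).card : ℝ≥0∞) ^ n ∂ν < ∞

/-- `ρ` is the correlation measure `K*ν` of `ν`: `ρ(A) = ∫ (K 1_A) dν` for all bounded measurable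
sets `A`. -/
def IsCorrelationMeasure [TopologicalSpace M] [MeasurableSpace M]
    (ν : Measure (Config M)) (ρ : Measure (FinConfig M)) : Prop :=
  ∀ A : Set (FinConfig M), MeasurableSet A → IsBoundedConfigSet A →
    ρ A = ∫⁻ γ, ENNReal.ofReal (kTransform (A.indicator fun _ => (1 : ℝ)) γ) ∂ν

/-- The Lebesgue-Poisson measure `λ_μ = ∑ₙ (1 / n!) μ⁽ⁿ⁾`. -/
def lebesguePoisson [TopologicalSpace M] [MeasurableSpace M] (μ : Measure M) :
    Measure (FinConfig M) :=
  Measure.sum fun n : ℕ => ENNReal.ofReal (1 / (n ! : ℝ)) • pointMeasure μ n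

/-- The fractional Lebesgue-Poisson measure `λ_μ^α = ∑ₙ (1 / Γ(α n + 1)) μ⁽ⁿ⁾`. -/
def fracLebesguePoisson [TopologicalSpace M] [MeasurableSpace M] (α : ℝ) (μ : Measure M) :
    Measure (FinConfig M) :=
  Measure.sum fun n : ℕ => ENNReal.ofReal (1 / Real.Gamma (α * n + 1)) • pointMeasure μ n

end FracPoisson

end

/-! The law of a random configuration is determined by its void probabilities, the chances of
missing a set `B`. The avoidance events form a π-system, since missing `B` and `C` means missing `B
∪ C`, and they generate both Borel σ-algebras (`Config.measurableSpace_eq`,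
`FinConfig.measurableSpace_eq`). The main identities between measures thus reduce to void
probabilities.

These are integrals of products `∏ x ∈ η, g x`. As `μ` has no atoms, such a product integrates to
`(∫ g)ⁿ` against the `n`-point measure. Against the local fractional Poisson measure on `Λ`,
Taylor's formula at `-μ(Λ)` then gives `E_α(-μ(Λ) + ∫_Λ g)` (`lintegral_prod_localFracPoisson`). For
`g = 𝟙_{Bᶜ}` this is the void probability `E_α(-μ(B ∩ Λ))`. For `g = 1 + 𝟙_{Bᶜ}` the product counts
the subsets of `η` missing `B`, and the term `-μ(Λ)` cancels, leaving `E_α(μ(Bᶜ ∩ Λ))`: exactly the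
mass which the fractional Lebesgue-Poisson measure of `μ` restricted to `Λ` gives to avoiding `B`
(`bind_subsetsMeasure`). This is the correlation identity.

Existence, and the nonnegativity of the coefficients, rest on `E_α` being the moment generating
function of a probability law on `[0, ∞)` with moments `n!/Γ(αn+1)`. It is the law of `S ^ (-α)`,
where `S` is one-sided `α`-stable, built as the sum of the points of a Poisson process with density
proportional to `x ^ (-1-α)` (`exists_stable`, `exists_isMittagLefflerLaw`). Mixing Poisson
processes of intensity `t μ` over this law gives void probabilities `∫ exp(-t μ(B)) = E_α(-μ(B))`
(`exists_measure_avoiding`), so the global measure is obtained without a projective limit. -/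

noncomputable section

namespace FracPoisson

set_option linter.unusedSectionVars false

open TopologicalSpace Function Filter Topology

/-! ### Point counts and avoidance events -/

section Counting

variable {M : Type*} [TopologicalSpace M] [T2Space M] [SecondCountableTopology M]

/-- A set has at least `k` points in `B` iff it meets `B` in `k` disjoint basic open sets. -/
theorem le_encard_inter_iff (S B : Set M) (k : ℕ) :
    (k : ℕ∞) ≤ (S ∩ B).encard ↔ ∃ U : Fin k → countableBasis M,
      Pairwise (Disjoint on fun i => (U i : Set M)) ∧ ∀ i, ¬ Disjoint S (B ∩ U i) := by
  constructor
  · intro h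
    obtain ⟨T, hT, hcard⟩ := Set.exists_subset_encard_eq h
    have hfin : T.Finite := Set.finite_of_encard_eq_coe hcard
    obtain ⟨V, hV, hdisj⟩ := hfin.t2_separation
    have hc : hfin.toFinset.card = k := by
      rw [hfin.encard_eq_coe_toFinset_card] at hcard
      exact_mod_cast hcard
    let e := (hfin.toFinset.equivFinOfCardEq hc).symm
    have hbasis : ∀ x, ∃ U : countableBasis M, x ∈ (U : Set M) ∧ (U : Set M) ⊆ V x := by
      intro x
      obtain ⟨U, hU, hxU, hUV⟩ :=
        (isBasis_countableBasis M).exists_subset_of_mem_open (hV x).1 (hV x).2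
      exact ⟨⟨U, hU⟩, hxU, hUV⟩
    choose U hxU hUV using hbasis
    refine ⟨fun i => U (e i), ?_, fun i => ?_⟩
    · intro i j hij
      have : (e i : M) ≠ e j := fun h => hij (e.injective (Subtype.ext h))
      exact (hdisj (hfin.mem_toFinset.1 (e i).2) (hfin.mem_toFinset.1 (e j).2) this).mono (hUV _) (hUV _)
    · have hm : (e i : M) ∈ T := hfin.mem_toFinset.1 (e i).2
      exact Set.not_disjoint_iff.2 ⟨e i, (hT hm).1, (hT hm).2, hxU _⟩
  · rintro ⟨U, hU, hS⟩
    have : ∀ i, ∃ x, x ∈ S ∧ x ∈ B ∩ U i := fun i => Set.not_disjoint_iff.1 (hS i)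
    choose y hyS hyB using this
    have hinj : Injective y := by
      intro i j hij
      by_contra hne
      exact Set.disjoint_left.1 (hU hne) (hyB i).2 (hij ▸ (hyB j).2)
    calc (k : ℕ∞) = (Set.range y).encard := by
          rw [← Set.image_univ, hinj.encard_image]; simp
      _ ≤ _ := Set.encard_le_encard (by rintro _ ⟨i, rfl⟩; exact ⟨hyS i, (hyB i).1⟩)

/-- The number of points of a random set in `B` is measurable as soon as the events of avoiding
the traces on `B` of open sets are. -/
theorem measurable_encard_inter {X : Type*} [MeasurableSpace X] {S : X → Set M} {B : Set M}
    (h : ∀ U, IsOpen U → MeasurableSet {x | Disjoint (S x) (B ∩ U)}) :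
    Measurable fun x => (S x ∩ B).encard := by
  have hle : ∀ k : ℕ, MeasurableSet {x | (k : ℕ∞) ≤ (S x ∩ B).encard} := by
    intro k
    simp_rw [le_encard_inter_iff]
    have : {x | ∃ U : Fin k → countableBasis M, Pairwise (Disjoint on fun i => (U i : Set M)) ∧
        ∀ i, ¬ Disjoint (S x) (B ∩ U i)} = ⋃ U : Fin k → countableBasis M,
          ⋃ (_ : Pairwise (Disjoint on fun i => (U i : Set M))),
            ⋂ i, {x | Disjoint (S x) (B ∩ U i)}ᶜ := by
      ext; simp
    rw [this]
    exact .iUnion fun U => .iUnion fun _ => .iInter fun i =>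
      (h _ (isOpen_of_mem_countableBasis (U i).2)).compl
  refine measurable_to_countable' fun y => ?_
  induction y with
  | top =>
    have : (fun x => (S x ∩ B).encard) ⁻¹' {⊤} = ⋂ k : ℕ, {x | (k : ℕ∞) ≤ (S x ∩ B).encard} := by
      ext x
      simp [ENat.eq_top_iff_forall_ge]
    rw [this]
    exact .iInter hle
  | coe n =>
    have : (fun x => (S x ∩ B).encard) ⁻¹' {(n : ℕ∞)} =
        {x | (n : ℕ∞) ≤ (S x ∩ B).encard} \ {x | ((n + 1 : ℕ) : ℕ∞) ≤ (S x ∩ B).encard} := by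
      ext x
      simp only [Set.mem_preimage, Set.mem_singleton_iff, Set.mem_sdiff, Set.mem_ofPred_eq, not_le,
        Nat.cast_add, Nat.cast_one]
      rw [ENat.lt_add_one_iff (by simp)]
      exact ⟨fun h => ⟨h.ge, h.le⟩, fun h => le_antisymm h.2 h.1⟩
    rw [this]
    exact (hle n).diff (hle _)

end Counting

/-- The configurations without points in `B`. -/
def Config.avoiding {M : Type*} [TopologicalSpace M] (B : Set M) : Set (Config M) :=
  {γ | Disjoint γ.points B}

/-- The finite configurations without points in `B`. -/
def FinConfig.avoiding {M : Type*} (B : Set M) : Set (FinConfig M) :=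
  {η | Disjoint (η.points : Set M) B}

/-! ### The Borel structure of the locally finite configurations -/

section Config

variable {M : Type*} [TopologicalSpace M]

theorem Config.mem_avoiding {B : Set M} {γ : Config M} :
    γ ∈ Config.avoiding B ↔ Disjoint γ.points B := Iff.rfl

theorem FinConfig.mem_avoiding {B : Set M} {η : FinConfig M} :
    η ∈ FinConfig.avoiding B ↔ Disjoint (η.points : Set M) B := Iff.rfl

theorem Config.finite_inter (γ : Config M) {B : Set M} (hB : IsCompact (closure B)) :
    (γ.points ∩ B).Finite :=
  (γ.2 _ hB).subset (Set.inter_subset_inter_right _ subset_closure)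

theorem Config.continuous_pairing (f : C_c(M, ℝ)) :
    Continuous fun γ : Config M => γ.pairing f :=
  continuous_iInf_dom continuous_induced_dom

theorem Config.pairing_eq_sum {γ : Config M} {f : C_c(M, ℝ)} {s : Finset M} {W : Set M}
    (hf : support f ⊆ W) (hs : γ.points ∩ W = s) : γ.pairing f = ∑ x ∈ s, f x := by
  refine finsum_mem_eq_sum_of_inter_support_eq _ ?_
  rw [← hs, Set.inter_assoc, Set.inter_eq_right.2 hf]

theorem Config.avoiding_inter (B C : Set M) :
    Config.avoiding B ∩ Config.avoiding C = Config.avoiding (B ∪ C) := by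
  ext γ; simp [Config.avoiding]

theorem FinConfig.avoiding_inter (B C : Set M) :
    FinConfig.avoiding B ∩ FinConfig.avoiding C = FinConfig.avoiding (B ∪ C) := by
  ext γ; simp [FinConfig.avoiding]

variable [T2Space M] [LocallyCompactSpace M]

/-- A configuration misses `U` iff it pairs to zero with every nonnegative test function supported
in `U`; a Urysohn bump detects each point of `U`. -/
theorem Config.isClosed_avoiding {U : Set M} (hU : IsOpen U) :
    IsClosed (Config.avoiding U) := by
  have : Config.avoiding U = ⋂ f : {f : C_c(M, ℝ) // 0 ≤ ⇑f ∧ support f ⊆ U},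
      {γ : Config M | γ.pairing f.1 = 0} := by
    ext γ
    simp only [Set.mem_iInter, Set.mem_ofPred_eq, Subtype.forall, Config.mem_avoiding]
    constructor
    · rintro h f ⟨-, hf⟩
      have := Config.pairing_eq_sum (γ := γ) (f := f) (s := ∅) hf
        (by simpa using h.inter_eq)
      simpa using this
    · intro h
      rw [Set.disjoint_left]
      intro x hx hxU
      obtain ⟨f, hf1, hf0, hfc, hf⟩ := exists_continuous_one_zero_of_isCompact
        (isCompact_singleton (x := x)) hU.isClosed_compl (by simpa using hxU)
      let F : C_c(M, ℝ) := ⟨f, hfc⟩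
      have hFs : support F ⊆ U := by
        intro y hy
        by_contra hyU
        exact hy (hf0 hyU)
      have hfin : (γ.points ∩ tsupport F).Finite := γ.2 _ hfc
      have hsum := h F ⟨fun y => (hf y).1, hFs⟩
      rw [Config.pairing_eq_sum (s := hfin.toFinset) (W := tsupport F)
        (subset_tsupport _) (by simp),
        Finset.sum_eq_zero_iff_of_nonneg (f := F) fun y _ => (hf y).1] at hsum
      have hFx : F x = 1 := hf1 (by simp)
      have := hsum x (by
        simp only [Set.Finite.mem_toFinset]
        exact ⟨hx, subset_tsupport _ (by simp [hFx])⟩)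
      rw [hFx] at this
      exact one_ne_zero this
  rw [this]
  exact isClosed_iInter fun f => isClosed_singleton.preimage (Config.continuous_pairing f.1)

instance Config.borelSpace : BorelSpace (Config M) := ⟨rfl⟩

instance FinConfig.borelSpace : BorelSpace (FinConfig M) := ⟨rfl⟩

variable [SecondCountableTopology M] [MeasurableSpace M] [BorelSpace M]

/-- The counting measure of `γ ∩ W`, for a relatively compact open `W ⊇ B`, is finite and depends
measurably on `γ` when evaluated on open sets. The π-λ theorem extends this to all Borel sets, and
avoiding `B` is the event that the count on `B` vanishes. -/
theorem Config.measurableSet_avoiding {B : Set M} (hB : IsBoundedBorel B) :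
    MeasurableSet (Config.avoiding B) := by
  obtain ⟨W, hW, hBW, hWc⟩ := exists_isOpen_superset_and_isCompact_closure hB.isCompact_closure
  have hm : ∀ γ : Config M, MeasurableSet (γ.points ∩ W) :=
    fun γ => (γ.finite_inter hWc).measurableSet
  let κ : Config M → Measure M := fun γ => Measure.count.restrict (γ.points ∩ W)
  have hκ : ∀ γ, ∀ s, MeasurableSet s → κ γ s = ((γ.points ∩ (s ∩ W)).encard : ℝ≥0∞) := by
    intro γ s hs
    rw [Measure.restrict_apply hs, Measure.count_apply (hs.inter (hm γ))]
    congr 2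
    ext; simp; tauto
  have : ∀ γ, IsFiniteMeasure (κ γ) := fun γ => ⟨by
    rw [hκ γ _ .univ, Set.univ_inter, (γ.finite_inter hWc).encard_eq_coe_toFinset_card]
    simp⟩
  have hopen : ∀ U : Set M, IsOpen U → Measurable fun γ => κ γ U := by
    intro U hU
    simp_rw [hκ _ U hU.measurableSet]
    exact (measurable_from_top (f := fun n : ℕ∞ => (n : ℝ≥0∞))).comp
      (measurable_encard_inter fun V hV =>
        (Config.isClosed_avoiding ((hU.inter hW).inter hV)).measurableSet)
  have hκm : Measurable κ := Measurable.measure_of_isPiSystem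
    (BorelSpace.measurable_eq (α := M)) isPiSystem_isOpen hopen (hopen _ isOpen_univ)
  have : Config.avoiding B = (fun γ => κ γ B) ⁻¹' {0} := by
    ext γ
    simp only [Set.mem_preimage, Set.mem_singleton_iff, hκ γ B hB.measurableSet,
      Config.mem_avoiding, Set.inter_eq_left.2 (subset_closure.trans hBW)]
    simp [Set.disjoint_iff_inter_eq_empty]
  rw [this]
  exact (Measure.measurable_coe hB.measurableSet).comp hκm (measurableSet_singleton 0)

theorem isBoundedBorel_inter {B W : Set M} (hB : MeasurableSet B) (hW : IsBoundedBorel W) :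
    IsBoundedBorel (B ∩ W) :=
  ⟨hB.inter hW.1, hW.2.of_isClosed_subset isClosed_closure
    (closure_mono Set.inter_subset_right)⟩

theorem isBoundedBorel_union {B C : Set M} (hB : IsBoundedBorel B) (hC : IsBoundedBorel C) :
    IsBoundedBorel (B ∪ C) :=
  ⟨hB.1.union hC.1, by rw [closure_union]; exact hB.2.union hC.2⟩

theorem isBoundedBorel_interior (K : CompactExhaustion M) (p : ℕ) :
    IsBoundedBorel (interior (K p)) :=
  ⟨isOpen_interior.measurableSet, (K.isCompact p).of_isClosed_subset isClosed_closure
    (closure_minimal interior_subset (K.isCompact p).isClosed)⟩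

theorem exists_subset_interior_compactExhaustion (K : CompactExhaustion M) {s : Set M}
    (hs : IsCompact s) : ∃ p, s ⊆ interior (K p) := by
  obtain ⟨n, hn⟩ := K.exists_superset_of_isCompact hs
  exact ⟨n + 1, hn.trans (K.subset_interior_succ n)⟩

variable (M) in
/-- The events of avoiding a bounded Borel set. -/
def Config.avoidingEvents : Set (Set (Config M)) :=
  {s | ∃ B : Set M, IsBoundedBorel B ∧ Config.avoiding B = s}

variable (M) in
/-- The events of avoiding a Borel set. -/
def FinConfig.avoidingEvents : Set (Set (FinConfig M)) :=
  {s | ∃ B : Set M, MeasurableSet B ∧ FinConfig.avoiding B = s}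

theorem Config.isPiSystem_avoidingEvents : IsPiSystem (Config.avoidingEvents M) := by
  rintro _ ⟨B, hB, rfl⟩ _ ⟨C, hC, rfl⟩ -
  exact ⟨B ∪ C, isBoundedBorel_union hB hC, (Config.avoiding_inter B C).symm⟩

theorem FinConfig.isPiSystem_avoidingEvents : IsPiSystem (FinConfig.avoidingEvents M) := by
  rintro _ ⟨B, hB, rfl⟩ _ ⟨C, hC, rfl⟩ -
  exact ⟨B ∪ C, hB.union hC, (FinConfig.avoiding_inter B C).symm⟩

/-- Disjoint small neighbourhoods, taken from the countable basis, of finitely many points. -/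
theorem exists_disjoint_basis {s : Set M} (hs : s.Finite) {V : M → Set M}
    (hV : ∀ x, x ∈ V x ∧ IsOpen (V x)) :
    ∃ U : M → countableBasis M, (∀ x, x ∈ (U x : Set M) ∧ (U x : Set M) ⊆ V x) ∧
      s.PairwiseDisjoint fun x => (U x : Set M) := by
  obtain ⟨V', hV', hdisj⟩ := hs.t2_separation
  have hbasis : ∀ x, ∃ U : countableBasis M, x ∈ (U : Set M) ∧ (U : Set M) ⊆ V x ∩ V' x := by
    intro x
    obtain ⟨U, hU, hxU, hUV⟩ :=
      (isBasis_countableBasis M).exists_subset_of_mem_open (a := x) (u := V x ∩ V' x)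
        ⟨(hV x).1, (hV' x).1⟩ ((hV x).2.inter (hV' x).2)
    exact ⟨⟨U, hU⟩, hxU, hUV⟩
  choose U hxU hUV using hbasis
  exact ⟨U, fun x => ⟨hxU x, (hUV x).trans Set.inter_subset_left⟩,
    fun x hx y hy hxy => (hdisj hx hy hxy).mono ((hUV x).trans Set.inter_subset_right)
      ((hUV y).trans Set.inter_subset_right)⟩

/-- A set with at most as many points as there are disjoint sets which it meets consists of one
point in each of them. -/
theorem eq_image_of_encard_le {S : Set M} {s : Finset M} {U : M → Set M}
    (hU : (s : Set M).PairwiseDisjoint U) (hS : S.encard ≤ s.card)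
    {y : M → M} (hy : ∀ x ∈ s, y x ∈ S ∩ U x) :
    Set.InjOn y s ∧ S = y '' s := by
  have hinj : Set.InjOn y s := by
    intro a ha b hb hab
    by_contra hne
    exact Set.disjoint_left.1 (hU ha hb hne) (hy a ha).2 (hab ▸ (hy b hb).2)
  refine ⟨hinj, ((s.finite_toSet.image y).eq_of_subset_of_encard_le ?_ ?_).symm⟩
  · rintro _ ⟨x, hx, rfl⟩
    exact (hy x hx).1
  · rwa [hinj.encard_image, Set.encard_coe_eq_coe_finsetCard]

/-- For the hard inclusion, the vague topology is compared with a finer topology `T` having a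
countable subbasis of sets in the generated σ-algebra: upper bounds on counts, and hitting events.
Second countability makes the Borel sets of `T` generated by this subbasis, and they include the
vague ones. -/
theorem Config.measurableSpace_eq :
    Config.instMeasurableSpace = MeasurableSpace.generateFrom (Config.avoidingEvents M) := by
  refine le_antisymm ?_ ?_
  · have K : CompactExhaustion M := default
    let C : Set (Set (Config M)) :=
      Set.range (fun q : ℕ × ℕ =>
        {γ : Config M | (γ.points ∩ interior (K q.1)).encard ≤ (q.2 : ℕ∞)}) ∪
      Set.range (fun q : countableBasis M × ℕ =>
        (Config.avoiding ((q.1 : Set M) ∩ interior (K q.2)))ᶜ)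
    have hC : C.Countable := (Set.countable_range _).union (Set.countable_range _)
    let T : TopologicalSpace (Config M) := TopologicalSpace.generateFrom C
    have hT : T ≤ Config.instTopologicalSpace := by
      refine le_iInf fun f => ?_
      rw [← continuous_iff_le_induced, continuous_iff_continuousAt]
      intro γ
      obtain ⟨p, hp⟩ := exists_subset_interior_compactExhaustion K f.hasCompactSupport
      set W := interior (K p)
      have hsupp : support f ⊆ W := (subset_tsupport _).trans hp
      have hfin : (γ.points ∩ W).Finite := γ.finite_inter (isBoundedBorel_interior K p).2
      set s := hfin.toFinset with hs
      have hsW : γ.points ∩ W = s := by simp [hs]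
      have hpos : (0 : ℝ) < s.card + 1 := Nat.cast_add_one_pos _
      -- The denominator `s.card + 1` keeps the tolerance defined when `s` is empty and makes the
      -- final bound strict.
      refine Metric.tendsto_nhds.2 fun ε hε => ?_
      obtain ⟨U, hU, hdisj⟩ := exists_disjoint_basis (s := (s : Set M)) s.finite_toSet
        (V := fun x => {y | dist (f y) (f x) < ε / (s.card + 1)})
        (fun x => ⟨(dist_self (f x)).trans_lt (div_pos hε hpos),
          isOpen_lt (f.continuous.dist continuous_const) continuous_const⟩)
      -- At most `s.card` points, and one in each of `s.card` disjoint sets: exactly one point of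
      -- `γ'` lies near each point of `γ` in `W`.
      have hnear : {γ' : Config M | (γ'.points ∩ W).encard ≤ (s.card : ℕ∞)} ∩
          ⋂ x ∈ s, (Config.avoiding ((U x : Set M) ∩ W))ᶜ ∈ @nhds _ T γ := by
        refine Filter.inter_mem ?_ ((Filter.biInter_finset_mem s).2 fun x hx => ?_)
        · refine IsOpen.mem_nhds (isOpen_generateFrom_of_mem (Or.inl ⟨(p, s.card), rfl⟩)) ?_
          simp only [Set.mem_ofPred_eq, hsW, Set.encard_coe_eq_coe_finsetCard, le_refl]
        · refine IsOpen.mem_nhds (isOpen_generateFrom_of_mem (Or.inr ⟨(U x, p), rfl⟩)) ?_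
          have hx' : x ∈ γ.points ∩ W := by rw [hsW]; exact hx
          exact Set.not_disjoint_iff.2 ⟨x, hx'.1, (hU x).1, hx'.2⟩
      filter_upwards [hnear] with γ' hγ'
      have hy : ∀ x, ∃ y, x ∈ s → y ∈ (γ'.points ∩ W) ∩ U x := by
        intro x
        by_cases hx : x ∈ s
        · obtain ⟨y, h1, h2⟩ := Set.not_disjoint_iff.1 (Set.mem_iInter₂.1 hγ'.2 x hx)
          exact ⟨y, fun _ => ⟨⟨h1, h2.2⟩, h2.1⟩⟩
        · exact ⟨x, fun h => absurd h hx⟩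
      choose y hy using hy
      obtain ⟨hinj, himg⟩ := eq_image_of_encard_le hdisj hγ'.1 hy
      classical
      rw [Config.pairing_eq_sum hsupp hsW, Config.pairing_eq_sum (s := s.image y) hsupp
        (by rw [himg, Finset.coe_image]), Finset.sum_image hinj]
      calc dist (∑ x ∈ s, f (y x)) (∑ x ∈ s, f x) ≤ ∑ x ∈ s, dist (f (y x)) (f x) :=
            dist_sum_sum_le _ _ _
        _ ≤ ∑ x ∈ s, ε / (s.card + 1) :=
            Finset.sum_le_sum fun x hx => ((hU x).2 (hy x hx).2).le
        _ = ε * (s.card / (s.card + 1)) := by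
            rw [Finset.sum_const, nsmul_eq_mul]
            ring
        _ < ε * 1 := by
            gcongr
            rw [div_lt_one hpos]
            exact lt_add_one _
        _ = ε := mul_one _
    have hsc : @SecondCountableTopology _ T := ⟨⟨C, hC, rfl⟩⟩
    refine (borel_anti hT).trans ?_
    rw [borel_eq_generateFrom_of_subbasis (t := T) rfl]
    refine MeasurableSpace.generateFrom_le ?_
    have hav : ∀ B : Set M, IsBoundedBorel B →
        MeasurableSet[MeasurableSpace.generateFrom (Config.avoidingEvents M)]
          (Config.avoiding B) :=
      fun B hB => MeasurableSpace.measurableSet_generateFrom ⟨B, hB, rfl⟩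
    rintro _ (⟨⟨p, n⟩, rfl⟩ | ⟨⟨U, p⟩, rfl⟩)
    · refine @measurable_encard_inter M _ _ _ _ (MeasurableSpace.generateFrom
        (Config.avoidingEvents M)) (fun γ : Config M => γ.points) (interior (K p))
        (fun V hV => hav _ ?_) (Set.Iic (n : ℕ∞)) trivial
      rw [Set.inter_comm]
      exact isBoundedBorel_inter hV.measurableSet (isBoundedBorel_interior K p)
    · exact (hav _ (isBoundedBorel_inter (isOpen_of_mem_countableBasis U.2).measurableSet
        (isBoundedBorel_interior K p))).compl
  · refine MeasurableSpace.generateFrom_le ?_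
    rintro _ ⟨B, hB, rfl⟩
    exact Config.measurableSet_avoiding hB

end Config

/-! ### The Borel structure of the finite configurations, and projections -/

section FinConfig

variable {M : Type*}

theorem FinConfig.points_sym (n : ℕ) (x : DistinctTuple M n) :
    ((sym n x).points : Set M) = Set.range x.1 := by
  simp [sym, FinConfig.points]

theorem FinConfig.card_sym (n : ℕ) (x : DistinctTuple M n) : (sym n x).card = n := by
  simp [sym, FinConfig.points, FinConfig.card]

theorem FinConfig.sum_sym {R : Type*} [AddCommMonoid R] (n : ℕ) (x : DistinctTuple M n)
    (f : M → R) : ∑ y ∈ (sym n x).points, f y = ∑ i, f (x.1 i) := by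
  simp [sym, FinConfig.points]

theorem FinConfig.prod_sym {R : Type*} [CommMonoid R] (n : ℕ) (x : DistinctTuple M n)
    (f : M → R) : ∏ y ∈ (sym n x).points, f y = ∏ i, f (x.1 i) := by
  simp [sym, FinConfig.points]

theorem FinConfig.exists_sym_eq (η : FinConfig M) : ∃ x, sym η.card x = η := by
  let e := (η.points.equivFin).symm
  refine ⟨⟨fun i => e i, fun i j h => e.injective (Subtype.ext h)⟩, ?_⟩
  apply Finset.coe_injective
  refine (FinConfig.points_sym _ _).trans ?_
  ext y
  simp only [Set.mem_range]
  constructor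
  · rintro ⟨i, rfl⟩
    exact (e i).2
  · intro hy
    exact ⟨e.symm ⟨y, hy⟩, by simp⟩

variable [TopologicalSpace M]

theorem FinConfig.isOpen_iff {O : Set (FinConfig M)} :
    IsOpen O ↔ ∀ n, IsOpen (sym (M := M) n ⁻¹' O) := by
  simp only [isOpen_iSup_iff, isOpen_coinduced]

theorem FinConfig.continuous_sym (n : ℕ) : Continuous (sym (M := M) n) :=
  continuous_def.2 fun _ hO => FinConfig.isOpen_iff.1 hO n

/-- A finite configuration as a locally finite one. -/
def FinConfig.toConfig (η : FinConfig M) : Config M :=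
  ⟨η.points, fun _ _ => η.points.finite_toSet.subset Set.inter_subset_left⟩

theorem FinConfig.points_toConfig (η : FinConfig M) : η.toConfig.points = η.points := rfl

theorem FinConfig.continuous_toConfig : Continuous (FinConfig.toConfig (M := M)) := by
  refine continuous_iInf_rng.2 fun f => continuous_induced_rng.2 ?_
  refine continuous_iSup_dom.2 fun n => continuous_coinduced_dom.2 ?_
  have : (((fun γ : Config M => γ.pairing f) ∘ FinConfig.toConfig) ∘ sym n) =
      fun x : DistinctTuple M n => ∑ i, f (x.1 i) := by
    ext x
    rw [← FinConfig.sum_sym]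
    exact Config.pairing_eq_sum (Set.subset_univ _) (by simp [FinConfig.points_toConfig])
  rw [this]
  exact continuous_finsetSum _ fun i _ =>
    f.continuous.comp ((continuous_apply i).comp continuous_subtype_val)

variable [T2Space M] [LocallyCompactSpace M] [SecondCountableTopology M] [MeasurableSpace M]
  [BorelSpace M]

/-- Pulled back from the locally finite configurations along a continuous map; cutting `B` by an
exhaustion supplies the boundedness needed there. -/
theorem FinConfig.measurableSet_avoiding {B : Set M} (hB : MeasurableSet B) :
    MeasurableSet (FinConfig.avoiding B) := by
  have K : CompactExhaustion M := default
  have : FinConfig.avoiding B =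
      ⋂ p, FinConfig.toConfig ⁻¹' Config.avoiding (B ∩ interior (K p)) := by
    ext η
    simp only [Set.mem_iInter, Set.mem_preimage, Config.mem_avoiding, FinConfig.mem_avoiding,
      FinConfig.points_toConfig]
    refine ⟨fun h p => h.mono_right Set.inter_subset_left, fun h => ?_⟩
    rw [Set.disjoint_left]
    intro x hx hxB
    obtain ⟨p, hp⟩ := exists_subset_interior_compactExhaustion K (isCompact_singleton (x := x))
    exact Set.disjoint_left.1 (h p) hx ⟨hxB, hp rfl⟩
  rw [this]
  exact .iInter fun p => FinConfig.continuous_toConfig.measurable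
    (Config.measurableSet_avoiding (isBoundedBorel_inter hB (isBoundedBorel_interior K p)))

/-- Again a finer, second countable topology is used. A configuration with at most `n` points which
hits small disjoint neighbourhoods of the `n` points of `η` is the image of a tuple close to an
ordering of `η`, hence lies in any given quotient-open set around `η`. -/
theorem FinConfig.measurableSpace_eq :
    FinConfig.instMeasurableSpace = MeasurableSpace.generateFrom (FinConfig.avoidingEvents M) := by
  refine le_antisymm ?_ ?_
  · let C : Set (Set (FinConfig M)) :=
      Set.range (fun q : ℕ => {η : FinConfig M | (η.points : Set M).encard ≤ (q : ℕ∞)}) ∪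
      Set.range (fun U : countableBasis M => (FinConfig.avoiding (U : Set M))ᶜ)
    have hC : C.Countable := (Set.countable_range _).union (Set.countable_range _)
    let T : TopologicalSpace (FinConfig M) := TopologicalSpace.generateFrom C
    have hT : T ≤ FinConfig.instTopologicalSpace := by
      intro O hO
      refine (@isOpen_iff_mem_nhds _ T O).2 ?_
      intro η hη
      obtain ⟨x, hx⟩ := η.exists_sym_eq
      obtain ⟨G, hG, hGO⟩ := isOpen_induced_iff.1 (FinConfig.isOpen_iff.1 hO η.card)
      have hxG : x.1 ∈ G := by
        have : x ∈ Subtype.val ⁻¹' G := by rw [hGO, Set.mem_preimage, hx]; exact hη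
        exact this
      obtain ⟨V, hV, hVG⟩ := isOpen_pi_iff'.1 hG x.1 hxG
      obtain ⟨U, hU, hdisj⟩ := exists_disjoint_basis (s := (η.points : Set M))
        η.points.finite_toSet (V := fun y => ⋂ i, ⋂ (_ : x.1 i = y), V i)
        (fun y => ⟨by simp only [Set.mem_iInter]; rintro i rfl; exact (hV i).2,
          isOpen_iInter_of_finite fun i => isOpen_iInter_of_finite fun _ => (hV i).1⟩)
      have hnear : {ζ : FinConfig M | (ζ.points : Set M).encard ≤ (η.card : ℕ∞)} ∩
          ⋂ y ∈ η.points, (FinConfig.avoiding (U y : Set M))ᶜ ∈ @nhds _ T η := by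
        refine Filter.inter_mem ?_ ((Filter.biInter_finset_mem η.points).2 fun y hy => ?_)
        · refine IsOpen.mem_nhds (isOpen_generateFrom_of_mem (Or.inl ⟨η.card, rfl⟩)) ?_
          simp only [Set.mem_ofPred_eq, Set.encard_coe_eq_coe_finsetCard]
          exact le_rfl
        · refine IsOpen.mem_nhds (isOpen_generateFrom_of_mem (Or.inr ⟨U y, rfl⟩)) ?_
          exact Set.not_disjoint_iff.2 ⟨y, hy, (hU y).1⟩
      filter_upwards [hnear] with ζ hζ
      have hy : ∀ z, ∃ y, z ∈ η.points → y ∈ (ζ.points : Set M) ∩ U z := by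
        intro z
        by_cases hz : z ∈ η.points
        · obtain ⟨y, h1, h2⟩ := Set.not_disjoint_iff.1 (Set.mem_iInter₂.1 hζ.2 z hz)
          exact ⟨y, fun _ => ⟨h1, h2⟩⟩
        · exact ⟨z, fun h => absurd h hz⟩
      choose y hy using hy
      obtain ⟨hinj, himg⟩ := eq_image_of_encard_le hdisj hζ.1 hy
      have hxη : (η.points : Set M) = Set.range x.1 := by
        rw [← FinConfig.points_sym, hx]
      have hmem : ∀ i, x.1 i ∈ η.points := fun i => by
        have : x.1 i ∈ (η.points : Set M) := hxη ▸ Set.mem_range_self i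
        exact this
      let x' : DistinctTuple M η.card :=
        ⟨fun i => y (x.1 i), fun i j hij => x.2 (hinj (hmem i) (hmem j) hij)⟩
      have hx' : sym η.card x' = ζ := by
        apply Finset.coe_injective
        refine (FinConfig.points_sym _ _).trans (Eq.trans ?_ himg.symm)
        rw [hxη, ← Set.range_comp]
        rfl
      have hmemO : x' ∈ sym η.card ⁻¹' O := by
        rw [← hGO]
        refine hVG fun i _ => ?_
        have := (hU (x.1 i)).2 (hy _ (hmem i)).2
        simp only [Set.mem_iInter] at this
        exact this i rfl
      rw [Set.mem_preimage, hx'] at hmemO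
      exact hmemO
    have hsc : @SecondCountableTopology _ T := ⟨⟨C, hC, rfl⟩⟩
    refine (borel_anti hT).trans ?_
    rw [borel_eq_generateFrom_of_subbasis (t := T) rfl]
    refine MeasurableSpace.generateFrom_le ?_
    have hav : ∀ B : Set M, MeasurableSet B →
        MeasurableSet[MeasurableSpace.generateFrom (FinConfig.avoidingEvents M)]
          (FinConfig.avoiding B) :=
      fun B hB => MeasurableSpace.measurableSet_generateFrom ⟨B, hB, rfl⟩
    rintro _ (⟨n, rfl⟩ | ⟨U, rfl⟩)
    · have := @measurable_encard_inter M _ _ _ _ (MeasurableSpace.generateFrom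
        (FinConfig.avoidingEvents M)) (fun η : FinConfig M => (η.points : Set M)) Set.univ
        (fun V hV => hav _ (MeasurableSet.univ.inter hV.measurableSet)) (Set.Iic (n : ℕ∞)) trivial
      simp only [Set.inter_univ] at this
      exact this
    · exact (hav _ (isOpen_of_mem_countableBasis U.2).measurableSet).compl
  · refine MeasurableSpace.generateFrom_le ?_
    rintro _ ⟨B, hB, rfl⟩
    exact FinConfig.measurableSet_avoiding hB

theorem FinConfig.measurable_encard_inter {B : Set M} (hB : MeasurableSet B) :
    Measurable fun η : FinConfig M => ((η.points : Set M) ∩ B).encard :=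
  FracPoisson.measurable_encard_inter fun _ hU =>
    FinConfig.measurableSet_avoiding (hB.inter hU.measurableSet)

theorem FinConfig.measurable_card : Measurable (FinConfig.card (M := M)) := by
  have h := FinConfig.measurable_encard_inter (M := M) .univ
  have : FinConfig.card (M := M) = fun η => (((η.points : Set M) ∩ Set.univ).encard).toNat := by
    ext η
    simp [FinConfig.card]
  rw [this]
  exact measurable_from_top.comp h

/-- Finite measures on `Γ` are determined by the probabilities of avoiding bounded Borel sets. -/
theorem Config.measure_ext {P Q : Measure (Config M)} [IsFiniteMeasure P]
    (h : ∀ B, IsBoundedBorel B → P (Config.avoiding B) = Q (Config.avoiding B)) : P = Q := by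
  refine ext_of_generate_finite _ Config.measurableSpace_eq Config.isPiSystem_avoidingEvents ?_ ?_
  · rintro _ ⟨B, hB, rfl⟩
    exact h B hB
  -- Every configuration avoids `∅`, so the total masses agree.
  · have := h ∅ ⟨.empty, by simp⟩
    simpa [Config.avoiding] using this

/-- Finite measures on `Γ₀` are determined by the probabilities of avoiding Borel sets. -/
theorem FinConfig.measure_ext {P Q : Measure (FinConfig M)} [IsFiniteMeasure P]
    (h : ∀ B, MeasurableSet B → P (FinConfig.avoiding B) = Q (FinConfig.avoiding B)) : P = Q := by
  refine ext_of_generate_finite _ FinConfig.measurableSpace_eq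
    FinConfig.isPiSystem_avoidingEvents ?_ ?_
  · rintro _ ⟨B, hB, rfl⟩
    exact h B hB
  · have := h ∅ .empty
    simpa [FinConfig.avoiding] using this

theorem coe_points_proj {Λ : Set M} (hΛ : IsCompact (closure Λ)) (γ : Config M) :
    ((proj Λ hΛ γ).points : Set M) = γ.points ∩ Λ := by
  simp [proj, FinConfig.points, Config.points]

theorem preimage_proj_avoiding {Λ : Set M} (hΛ : IsCompact (closure Λ)) (B : Set M) :
    proj Λ hΛ ⁻¹' FinConfig.avoiding B = Config.avoiding (B ∩ Λ) := by
  ext γ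
  simp only [Set.mem_preimage, FinConfig.mem_avoiding, Config.mem_avoiding, coe_points_proj,
    Set.disjoint_iff_inter_eq_empty]
  rw [Set.inter_assoc, Set.inter_comm Λ]

theorem measurable_proj {Λ : Set M} (hΛ : IsBoundedBorel Λ) :
    Measurable (proj Λ hΛ.isCompact_closure) := by
  rw [FinConfig.measurableSpace_eq]
  refine measurable_generateFrom ?_
  rintro _ ⟨B, hB, rfl⟩
  rw [preimage_proj_avoiding]
  exact Config.measurableSet_avoiding (isBoundedBorel_inter hB hΛ)

end FinConfig

/-! ### The exponential `exp (-t)` on `[0, ∞]` -/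

section ExpNeg

/-- The function `t ↦ exp (-t)` on `[0, ∞]`. -/
def expNeg (t : ℝ≥0∞) : ℝ≥0∞ := EReal.exp (-(t : EReal))

theorem continuous_expNeg : Continuous expNeg :=
  ENNReal.continuous_exp.comp (continuous_neg.comp continuous_coe_ennreal_ereal)

theorem expNeg_ofReal {r : ℝ} (hr : 0 ≤ r) :
    expNeg (ENNReal.ofReal r) = ENNReal.ofReal (Real.exp (-r)) := by
  rw [expNeg, EReal.coe_ennreal_ofReal, max_eq_left hr, ← EReal.coe_neg, EReal.exp_coe]

@[simp] theorem expNeg_zero : expNeg 0 = 1 := by simp [expNeg]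

@[simp] theorem expNeg_top : expNeg ⊤ = 0 := by simp [expNeg]

theorem expNeg_le_one (t : ℝ≥0∞) : expNeg t ≤ 1 := by
  induction t with
  | top => simp
  | coe t =>
    rw [← ENNReal.ofReal_coe_nnreal, expNeg_ofReal t.coe_nonneg]
    simp

theorem expNeg_add (s t : ℝ≥0∞) : expNeg (s + t) = expNeg s * expNeg t := by
  induction s with
  | top => simp
  | coe s =>
    induction t with
    | top => simp
    | coe t =>
      rw [← ENNReal.ofReal_coe_nnreal, ← ENNReal.ofReal_coe_nnreal, ← ENNReal.ofReal_add s.coe_nonneg t.coe_nonneg,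
        expNeg_ofReal (add_nonneg s.coe_nonneg t.coe_nonneg), expNeg_ofReal s.coe_nonneg, expNeg_ofReal t.coe_nonneg,
        ← ENNReal.ofReal_mul (Real.exp_pos _).le, ← Real.exp_add, neg_add]

theorem expNeg_sum {ι : Type*} (s : Finset ι) (f : ι → ℝ≥0∞) :
    expNeg (∑ i ∈ s, f i) = ∏ i ∈ s, expNeg (f i) := by
  classical
  induction s using Finset.induction_on with
  | empty => simp
  | insert i s hi ih => rw [Finset.sum_insert hi, Finset.prod_insert hi, expNeg_add, ih]

theorem tendsto_prod_expNeg (f : ℕ → ℝ≥0∞) :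
    Tendsto (fun K => ∏ k ∈ Finset.range K, expNeg (f k)) atTop (𝓝 (expNeg (∑' k, f k))) := by
  simp_rw [← expNeg_sum]
  exact (continuous_expNeg.tendsto _).comp ENNReal.summable.hasSum.tendsto_sum_nat

end ExpNeg

/-! ### Poisson samples and their Laplace functionals -/

section Sample

variable {X : Type*} [MeasurableSpace X]

theorem lintegral_pi_prod (μ : Measure X) [SigmaFinite μ] (n : ℕ) {g : X → ℝ≥0∞}
    (hg : Measurable g) :
    ∫⁻ x, ∏ i, g (x i) ∂(Measure.pi fun _ : Fin n => μ) = (∫⁻ x, g x ∂μ) ^ n := by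
  induction n with
  | zero => simp
  | succ n ih =>
    have hm : Measurable fun x : Fin n → X => ∏ i, g (x i) :=
      Finset.measurable_fun_prod _ fun i _ => hg.comp (measurable_pi_apply i)
    have h := (measurePreserving_piFinSuccAbove (fun _ : Fin (n + 1) => μ) 0).lintegral_comp
      (f := fun p => g p.1 * ∏ i, g (p.2 i))
      ((hg.comp measurable_fst).mul (hm.comp measurable_snd))
    rw [lintegral_prod_mul hg.aemeasurable hm.aemeasurable, ih] at h
    rw [pow_succ', ← h]
    refine lintegral_congr fun x => ?_
    rw [Fin.prod_univ_succ]
    simp [MeasurableEquiv.piFinSuccAbove, Fin.insertNthEquiv, Fin.tail]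

theorem measurable_sigma {ι Y : Type*} {β : ι → Type*} [∀ i, MeasurableSpace (β i)]
    [MeasurableSpace Y] {f : (Σ i, β i) → Y} (hf : ∀ i, Measurable fun x : β i => f ⟨i, x⟩) :
    Measurable f :=
  fun _ hs => MeasurableSpace.measurableSet_iInf.2 fun i => hf i hs

theorem measurable_sigmaMk {ι : Type*} {β : ι → Type*} [∀ i, MeasurableSpace (β i)] (i : ι) :
    Measurable (Sigma.mk (β := β) i) :=
  fun _ hs => MeasurableSpace.measurableSet_iInf.1 hs i

theorem measurable_prod_sample {g : X → ℝ≥0∞} (hg : Measurable g) :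
    Measurable fun ω : Σ n, (Fin n → X) => ∏ i, g (ω.2 i) :=
  measurable_sigma fun n => show Measurable fun x : Fin n → X => ∏ i : Fin n, g (x i) from
    Finset.measurable_fun_prod _ fun i _ => hg.comp (measurable_pi_apply i)

theorem tsum_ofReal_div_factorial_mul_pow {a : ℝ} (ha : 0 ≤ a) {c : ℝ} (hc : 0 ≤ c) :
    ∑' n : ℕ, ENNReal.ofReal (a / n !) * ENNReal.ofReal c ^ n =
      ENNReal.ofReal (a * Real.exp c) := by
  have h := (NormedSpace.expSeries_div_hasSum_exp c).mul_left a
  rw [← Real.exp_eq_exp_ℝ] at h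
  rw [← h.tsum_eq, ENNReal.ofReal_tsum_of_nonneg (fun n => by positivity) h.summable]
  refine tsum_congr fun n => ?_
  rw [← ENNReal.ofReal_pow hc, ← ENNReal.ofReal_mul (by positivity)]
  congr 1
  ring

/-- The law of a Poisson number of independent points: the ordered version of the Poisson process
with intensity the finite measure `μ`. -/
def poissonSample (μ : Measure X) : Measure (Σ n, (Fin n → X)) :=
  Measure.sum fun n : ℕ => ENNReal.ofReal (Real.exp (-(μ Set.univ).toReal) / n !) •
    (Measure.pi fun _ : Fin n => μ).map (Sigma.mk n)

/-- The `n`-point term contributes `(∫ g)ⁿ / n!`, so the exponential series sums to `exp(-μ(X))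
exp(∫ g)`. -/
theorem lintegral_poissonSample (μ : Measure X) [IsFiniteMeasure μ] {g : X → ℝ≥0∞}
    (hg : Measurable g) (hg1 : ∀ x, g x ≤ 1) :
    ∫⁻ ω, ∏ i, g (ω.2 i) ∂(poissonSample μ) = expNeg (∫⁻ x, (1 - g x) ∂μ) := by
  have hle : ∫⁻ x, g x ∂μ ≤ μ Set.univ := by
    simpa using lintegral_mono (μ := μ) hg1
  have hfin : ∫⁻ x, g x ∂μ ≠ ⊤ := ne_top_of_le_ne_top (measure_ne_top μ _) hle
  have hle' := ENNReal.toReal_mono (measure_ne_top μ _) hle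
  have hsub : ∫⁻ x, (1 - g x) ∂μ =
      ENNReal.ofReal ((μ Set.univ).toReal - (∫⁻ x, g x ∂μ).toReal) := by
    rw [lintegral_sub hg hfin (ae_of_all _ hg1), lintegral_one,
      ENNReal.ofReal_sub _ ENNReal.toReal_nonneg, ENNReal.ofReal_toReal hfin,
      ENNReal.ofReal_toReal (measure_ne_top μ _)]
  rw [hsub, expNeg_ofReal (sub_nonneg.2 hle'), poissonSample, lintegral_sum_measure]
  simp_rw [lintegral_smul_measure, smul_eq_mul,
    lintegral_map (measurable_prod_sample hg) (measurable_sigmaMk _), lintegral_pi_prod μ _ hg]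
  rw [← ENNReal.ofReal_toReal hfin, tsum_ofReal_div_factorial_mul_pow (Real.exp_pos _).le
    ENNReal.toReal_nonneg, ← Real.exp_add, ENNReal.ofReal_toReal hfin]
  congr 2
  ring

instance (μ : Measure X) [IsFiniteMeasure μ] : IsProbabilityMeasure (poissonSample μ) := ⟨by
  have := lintegral_poissonSample μ (g := fun _ => 1) measurable_const fun _ => le_rfl
  simpa using this⟩

/-- The law of independent Poisson samples with the intensities `μ k`. -/
def poissonSamples (μ : ℕ → Measure X) [∀ k, IsFiniteMeasure (μ k)] :
    Measure (ℕ → Σ n, (Fin n → X)) :=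
  Measure.infinitePi fun k => poissonSample (μ k)

instance (μ : ℕ → Measure X) [∀ k, IsFiniteMeasure (μ k)] :
    IsProbabilityMeasure (poissonSamples μ) := by
  unfold poissonSamples; infer_instance

/-- The Laplace functional of independent Poisson samples. -/
theorem tendsto_lintegral_poissonSamples (μ : ℕ → Measure X) [∀ k, IsFiniteMeasure (μ k)]
    {g : ℕ → X → ℝ≥0∞} (hg : ∀ k, Measurable (g k)) (hg1 : ∀ k x, g k x ≤ 1) :
    Tendsto (fun K => ∫⁻ ω, ∏ k ∈ Finset.range K, ∏ i, g k ((ω k).2 i) ∂(poissonSamples μ)) atTop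
      (𝓝 (expNeg (∑' k, ∫⁻ x, (1 - g k x) ∂(μ k)))) := by
  have hK : ∀ K, ∫⁻ ω, ∏ k ∈ Finset.range K, ∏ i, g k ((ω k).2 i) ∂(poissonSamples μ) =
      ∏ k ∈ Finset.range K, expNeg (∫⁻ x, (1 - g k x) ∂(μ k)) := by
    intro K
    have hind : ProbabilityTheory.iIndepFun (fun k (ω : ℕ → Σ n, (Fin n → X)) =>
        ∏ i, g k ((ω k).2 i)) (poissonSamples μ) :=
      ProbabilityTheory.iIndepFun_infinitePi (P := fun k => poissonSample (μ k))
        (X := fun k ω => ∏ i, g k (ω.2 i)) fun k => measurable_prod_sample (hg k)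
    rw [ProbabilityTheory.lintegral_prod_eq_prod_lintegral_of_indepFun _ _ hind
      fun k => (measurable_prod_sample (hg k)).comp (measurable_pi_apply k)]
    refine Finset.prod_congr rfl fun k _ => ?_
    rw [← lintegral_poissonSample (μ k) (hg k) (hg1 k)]
    exact (measurePreserving_eval_infinitePi (fun k => poissonSample (μ k)) k).lintegral_comp
      (measurable_prod_sample (hg k))
  simp_rw [hK]
  exact tendsto_prod_expNeg _

/-- Independence gives the finite products; dominated convergence with bound `1` passes to countably
many samples, even if the total intensity is infinite. -/
theorem lintegral_poissonSamples_of_tendsto (μ : ℕ → Measure X) [∀ k, IsFiniteMeasure (μ k)]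
    {g : ℕ → X → ℝ≥0∞} (hg : ∀ k, Measurable (g k)) (hg1 : ∀ k x, g k x ≤ 1)
    {G : (ℕ → Σ n, (Fin n → X)) → ℝ≥0∞}
    (hG : ∀ ω, Tendsto (fun K => ∏ k ∈ Finset.range K, ∏ i, g k ((ω k).2 i)) atTop (𝓝 (G ω))) :
    ∫⁻ ω, G ω ∂(poissonSamples μ) = expNeg (∑' k, ∫⁻ x, (1 - g k x) ∂(μ k)) := by
  refine tendsto_nhds_unique ?_ (tendsto_lintegral_poissonSamples μ hg hg1)
  refine tendsto_lintegral_of_dominated_convergence (fun _ => 1) (fun K => ?_) (fun K => ?_)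
    (by simp) (ae_of_all _ hG)
  · exact Finset.measurable_fun_prod _ fun k _ =>
      (measurable_prod_sample (hg k)).comp (measurable_pi_apply k)
  · exact ae_of_all _ fun ω => Finset.prod_le_one' fun k _ =>
      Finset.prod_le_one' fun i _ => hg1 _ _

end Sample

/-! ### The one-sided stable law and its negative moments -/

section Stable

open Set

variable {α : ℝ}

/-- Near `0` the bound `1 - exp(-x) ≤ x` leaves `x ^ (-α)`, integrable as `α < 1`; near infinity `x
^ (-1-α)` is integrable as `α > 0`. -/
theorem integrableOn_stable (hα0 : 0 < α) (hα1 : α < 1) :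
    IntegrableOn (fun x : ℝ => (1 - Real.exp (-x)) * x ^ (-1 - α)) (Ioi 0) := by
  have hmeas : Measurable fun x : ℝ => (1 - Real.exp (-x)) * x ^ (-1 - α) := by fun_prop
  rw [← Ioo_union_Ici_eq_Ioi (zero_lt_one' ℝ), integrableOn_union]
  constructor
  · have h : IntegrableOn (fun x : ℝ => x ^ (-α)) (Ioo 0 1) :=
      (intervalIntegral.integrableOn_Ioo_rpow_iff zero_lt_one).2 (by linarith)
    refine h.mono' hmeas.aestronglyMeasurable ?_
    filter_upwards [self_mem_ae_restrict measurableSet_Ioo] with x hx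
    have h1 : 1 - Real.exp (-x) ≤ x := by linarith [Real.add_one_le_exp (-x)]
    have h0 : 0 ≤ 1 - Real.exp (-x) := by simp [hx.1.le]
    rw [Real.norm_of_nonneg (mul_nonneg h0 (Real.rpow_nonneg hx.1.le _))]
    calc (1 - Real.exp (-x)) * x ^ (-1 - α) ≤ x * x ^ (-1 - α) :=
          mul_le_mul_of_nonneg_right h1 (Real.rpow_nonneg hx.1.le _)
      _ = x ^ (-α) := by
          rw [mul_comm, ← Real.rpow_add_one hx.1.ne']
          ring_nf
  · rw [integrableOn_Ici_iff_integrableOn_Ioi]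
    have h : IntegrableOn (fun x : ℝ => x ^ (-1 - α)) (Ioi 1) :=
      integrableOn_Ioi_rpow_of_lt (by linarith) zero_lt_one
    refine h.mono' hmeas.aestronglyMeasurable ?_
    filter_upwards [self_mem_ae_restrict measurableSet_Ioi] with x hx
    have hx0 : (0 : ℝ) < x := zero_lt_one.trans hx
    have h1 : 1 - Real.exp (-x) ≤ 1 := by linarith [Real.exp_pos (-x)]
    have h0 : 0 ≤ 1 - Real.exp (-x) := by simp [hx0.le]
    rw [Real.norm_of_nonneg (mul_nonneg h0 (Real.rpow_nonneg hx0.le _))]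
    exact mul_le_of_le_one_left (Real.rpow_nonneg hx0.le _) h1

/-- The normalising constant of the stable Lévy measure. -/
def stableConst (α : ℝ) : ℝ := ∫ x in Ioi (0 : ℝ), (1 - Real.exp (-x)) * x ^ (-1 - α)

theorem stableConst_pos (hα0 : 0 < α) (hα1 : α < 1) : 0 < stableConst α := by
  have hpos : ∀ x ∈ Ioi (0 : ℝ), 0 < (1 - Real.exp (-x)) * x ^ (-1 - α) := fun x hx =>
    mul_pos (by simpa using hx) (Real.rpow_pos_of_pos hx _)
  rw [stableConst, setIntegral_pos_iff_support_of_nonneg_ae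
    (ae_restrict_of_forall_mem measurableSet_Ioi fun x hx => (hpos x hx).le)
    (integrableOn_stable hα0 hα1)]
  have hsub : Ioi (0 : ℝ) ⊆ Function.support fun x : ℝ => (1 - Real.exp (-x)) * x ^ (-1 - α) :=
    fun x hx => (hpos x hx).ne'
  rw [inter_eq_right.2 hsub]
  simp

/-- The Lévy measure of the one-sided `α`-stable law with Laplace transform `exp (-s ^ α)`. -/
def stableLevy (α : ℝ) : Measure ℝ :=
  (volume.restrict (Ioi 0)).withDensity fun x => ENNReal.ofReal ((stableConst α)⁻¹ * x ^ (-1 - α))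

instance : SFinite (stableLevy α) := by unfold stableLevy; infer_instance

/-- The density is homogeneous: substituting `s x` produces `s ^ (1+α) · s⁻¹ = s ^ α`, and the
remaining integral is the normalising constant. -/
theorem lintegral_stableLevy (hα0 : 0 < α) (hα1 : α < 1) {s : ℝ} (hs : 0 < s) :
    ∫⁻ x, (1 - expNeg (ENNReal.ofReal s * ENNReal.ofReal x)) ∂(stableLevy α) =
      ENNReal.ofReal (s ^ α) := by
  have hC := stableConst_pos hα0 hα1
  let F : ℝ → ℝ := fun x => (1 - Real.exp (-x)) * x ^ (-1 - α)
  have hint : IntegrableOn (fun x => F (s * x)) (Ioi 0) := by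
    rw [integrableOn_Ioi_comp_mul_left_iff _ _ hs, mul_zero]
    exact integrableOn_stable hα0 hα1
  have hval : ∫ x in Ioi (0 : ℝ), F (s * x) = s⁻¹ * stableConst α := by
    rw [integral_comp_mul_left_Ioi F 0 hs, mul_zero, smul_eq_mul]
    rfl
  have hm : Measurable fun x : ℝ => 1 - expNeg (ENNReal.ofReal s * ENNReal.ofReal x) :=
    measurable_const.sub (continuous_expNeg.measurable.comp
      (measurable_const.mul ENNReal.measurable_ofReal))
  rw [stableLevy, lintegral_withDensity_eq_lintegral_mul _ (by fun_prop) hm]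
  have : ∀ x ∈ Ioi (0 : ℝ), ((fun x => ENNReal.ofReal ((stableConst α)⁻¹ * x ^ (-1 - α))) *
      fun x : ℝ => 1 - expNeg (ENNReal.ofReal s * ENNReal.ofReal x)) x =
      ENNReal.ofReal ((stableConst α)⁻¹ * s ^ (1 + α) * F (s * x)) := by
    intro x hx
    have hx0 : (0 : ℝ) < x := hx
    have h0 : 0 ≤ 1 - Real.exp (-(s * x)) := by simp [mul_nonneg hs.le hx0.le]
    simp only [Pi.mul_apply]
    rw [← ENNReal.ofReal_mul hs.le, expNeg_ofReal (mul_nonneg hs.le hx0.le), ← ENNReal.ofReal_one,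
      ← ENNReal.ofReal_sub _ (Real.exp_pos _).le, ← ENNReal.ofReal_mul' h0]
    congr 1
    simp only [F]
    rw [Real.mul_rpow hs.le hx0.le]
    have : s ^ (1 + α) * s ^ (-1 - α) = 1 := by
      rw [← Real.rpow_add hs]; simp
    linear_combination (-(stableConst α)⁻¹ * x ^ (-1 - α) * (1 - Real.exp (-(s * x)))) * this
  rw [setLIntegral_congr_fun measurableSet_Ioi this, ← ofReal_integral_eq_lintegral_ofReal
    (hint.const_mul _), integral_const_mul, hval]
  · congr 1
    rw [Real.rpow_add hs, Real.rpow_one]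
    field_simp
  · filter_upwards [self_mem_ae_restrict measurableSet_Ioi] with x hx
    have hx0 : (0 : ℝ) < x := hx
    have h0 : 0 ≤ 1 - Real.exp (-(s * x)) := by simp [mul_nonneg hs.le hx0.le]
    have := Real.rpow_nonneg (mul_nonneg hs.le hx0.le) (-1 - α)
    simp only [Pi.zero_apply, F]
    positivity

/-- The existence of the one-sided stable law, as the law of the sum of the points of a Poisson
process. -/
theorem exists_stable (hα0 : 0 < α) (hα1 : α < 1) :
    ∃ P : Measure ℝ≥0∞, IsProbabilityMeasure P ∧ ∀ s : ℝ, 0 < s →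
      ∫⁻ t, expNeg (ENNReal.ofReal s * t) ∂P = ENNReal.ofReal (Real.exp (-s ^ α)) := by
  -- The Lévy measure is infinite near `0`, so it is split into countably many finite intensities.
  -- The sum `T` may a priori be `⊤`, harmlessly: `expNeg ⊤ = 0` and `⊤ ^ (-α) = 0`.
  let μ : ℕ → Measure ℝ := sfiniteSeq (stableLevy α)
  let T : (ℕ → Σ n, (Fin n → ℝ)) → ℝ≥0∞ := fun ω => ∑' k, ∑ i, ENNReal.ofReal ((ω k).2 i)
  have hinner : Measurable fun ω : Σ n, (Fin n → ℝ) => ∑ i, ENNReal.ofReal (ω.2 i) :=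
    measurable_sigma fun n => show Measurable fun x : Fin n → ℝ => ∑ i : Fin n,
      ENNReal.ofReal (x i) by fun_prop
  have hT : Measurable T := Measurable.tsum fun k => hinner.comp (measurable_pi_apply k)
  refine ⟨(poissonSamples μ).map T, Measure.isProbabilityMeasure_map hT.aemeasurable,
    fun s hs => ?_⟩
  have hm : Measurable fun x : ℝ => expNeg (ENNReal.ofReal s * ENNReal.ofReal x) :=
    continuous_expNeg.measurable.comp (measurable_const.mul ENNReal.measurable_ofReal)
  have he : Measurable fun t : ℝ≥0∞ => expNeg (ENNReal.ofReal s * t) :=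
    continuous_expNeg.measurable.comp (measurable_const.mul measurable_id)
  rw [lintegral_map he hT,
    lintegral_poissonSamples_of_tendsto μ (fun _ => hm) fun _ _ => expNeg_le_one _,
    ← lintegral_sum_measure]
  · rw [sum_sfiniteSeq, lintegral_stableLevy hα0 hα1 hs, expNeg_ofReal (by positivity)]
  · intro ω
    have : ∀ k, ∏ i, expNeg (ENNReal.ofReal s * ENNReal.ofReal ((ω k).2 i)) =
        expNeg (ENNReal.ofReal s * ∑ i, ENNReal.ofReal ((ω k).2 i)) := fun k => by
      rw [Finset.mul_sum, expNeg_sum]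
    simp_rw [this, T, ← ENNReal.tsum_mul_left]
    exact tendsto_prod_expNeg _

/-- A rescaled Gamma integral: it writes negative powers as mixtures of exponentials, so that
Laplace transforms yield negative moments. -/
theorem lintegral_rpow_mul_expNeg {a : ℝ} (ha : 0 < a) {t : ℝ≥0∞} (ht : t ≠ 0) :
    ∫⁻ s in Ioi (0 : ℝ), ENNReal.ofReal (s ^ (a - 1)) * expNeg (ENNReal.ofReal s * t) =
      ENNReal.ofReal (Real.Gamma a) * t ^ (-a) := by
  induction t with
  | top =>
    rw [ENNReal.top_rpow_of_neg (by linarith), mul_zero]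
    refine (setLIntegral_congr_fun measurableSet_Ioi fun s hs => ?_).trans lintegral_zero
    have : ENNReal.ofReal s ≠ 0 := by simpa using hs
    rw [ENNReal.mul_top this]
    simp
  | coe r =>
    have hr : (0 : ℝ) < r := by
      have : r ≠ 0 := by simpa using ht
      exact_mod_cast pos_iff_ne_zero.2 this
    have hΓ := Real.Gamma_pos_of_pos ha
    have hval := Real.integral_rpow_mul_exp_neg_mul_Ioi ha hr
    have hpow : (1 / (r : ℝ)) ^ a = (r : ℝ) ^ (-a) := by
      rw [one_div, Real.inv_rpow hr.le, Real.rpow_neg hr.le]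
    -- A non-integrable function has integral `0` by convention, contradicting the positive value in
    -- `hval`.
    have hint : Integrable (fun t : ℝ => t ^ (a - 1) * Real.exp (-(r * t)))
        (volume.restrict (Ioi 0)) := by
      by_contra h
      rw [integral_undef h] at hval
      have : 0 < (1 / (r : ℝ)) ^ a * Real.Gamma a := by positivity
      exact this.ne hval
    rw [← ENNReal.ofReal_coe_nnreal, ENNReal.ofReal_rpow_of_pos hr, ← hpow,
      ← ENNReal.ofReal_mul hΓ.le, mul_comm (Real.Gamma a), ← hval,
      ofReal_integral_eq_lintegral_ofReal hint]
    · refine setLIntegral_congr_fun measurableSet_Ioi fun s hs => ?_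
      have hs0 : (0 : ℝ) < s := hs
      rw [← ENNReal.ofReal_mul hs0.le, expNeg_ofReal (by positivity),
        ← ENNReal.ofReal_mul (by positivity), mul_comm s]
    · filter_upwards [self_mem_ae_restrict measurableSet_Ioi] with s hs
      have hs0 : (0 : ℝ) < s := hs
      simp only [Pi.zero_apply]
      positivity

/-- A Mittag-Leffler law: a probability measure on `[0, ∞)` with the moments
`n! / Γ(α n + 1)`. -/
structure IsMittagLefflerLaw (α : ℝ) (ν : Measure ℝ) : Prop where
  isProbabilityMeasure : IsProbabilityMeasure ν
  ae_nonneg : ∀ᵐ t ∂ν, 0 ≤ t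
  lintegral_pow : ∀ n : ℕ, ∫⁻ t, ENNReal.ofReal (t ^ n) ∂ν =
    ENNReal.ofReal ((n ! : ℝ) / Real.Gamma (α * n + 1))

/-- The law of `S ^ (-α)` for a stable random variable `S` is a Mittag-Leffler law. -/
theorem exists_isMittagLefflerLaw (hα0 : 0 < α) (hα1 : α < 1) :
    ∃ ν : Measure ℝ, IsMittagLefflerLaw α ν := by
  obtain ⟨P, hP, hL⟩ := exists_stable hα0 hα1
  -- An atom at `0` would bound the Laplace transform from below, but `exp(-s ^ α)` tends to `0` as
  -- `s → ∞`.
  have hP0 : P {0} = 0 := by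
    have hle : ∀ s : ℝ, 0 < s → P {0} ≤ ENNReal.ofReal (Real.exp (-s ^ α)) := by
      intro s hs
      rw [← hL s hs, ← lintegral_indicator_one (measurableSet_singleton 0)]
      refine lintegral_mono fun t => ?_
      by_cases ht : t = 0
      · simp [ht]
      · simp [ht]
    have hlim : Tendsto (fun s : ℝ => ENNReal.ofReal (Real.exp (-s ^ α))) atTop (𝓝 0) := by
      rw [← ENNReal.ofReal_zero]
      exact (ENNReal.continuous_ofReal.tendsto _).comp
        (Real.tendsto_exp_neg_atTop_nhds_zero.comp (tendsto_rpow_atTop hα0))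
    exact le_antisymm (ge_of_tendsto hlim ((eventually_gt_atTop 0).mono hle)) bot_le
  have hmeas : Measurable fun t : ℝ≥0∞ => (t ^ (-α)).toReal := by fun_prop
  refine ⟨P.map fun t => (t ^ (-α)).toReal, Measure.isProbabilityMeasure_map hmeas.aemeasurable,
    (ae_map_iff hmeas.aemeasurable measurableSet_Ici).2 (ae_of_all _ fun t =>
      ENNReal.toReal_nonneg), fun n => ?_⟩
  -- The Gamma integral for `t ^ (-(α n))` needs `α n > 0`, so the total mass is treated separately.
  rcases n.eq_zero_or_pos with rfl | hn
  · rw [lintegral_map (by fun_prop) hmeas]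
    simp
  have ha : 0 < α * n := by positivity
  have hn0 : (0 : ℝ) < n := by positivity
  have hΓ := Real.Gamma_pos_of_pos ha
  have hΓn := Real.Gamma_pos_of_pos hn0
  -- The double integral of `s ^ (α n - 1) exp(-s t)` is computed in both orders; integrating out
  -- `t` first leaves the elementary integral of `s ^ (α n - 1) exp(-s ^ α)`.
  have hmom : ENNReal.ofReal (Real.Gamma (α * n)) * ∫⁻ t, t ^ (-(α * n)) ∂P =
      ENNReal.ofReal (1 / α * Real.Gamma n) := by
    have hval := integral_rpow_mul_exp_neg_rpow (p := α) (q := α * n - 1) hα0 (by linarith)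
    rw [sub_add_cancel, mul_div_cancel_left₀ _ hα0.ne'] at hval
    have hint : Integrable (fun x : ℝ => x ^ (α * n - 1) * Real.exp (-x ^ α))
        (volume.restrict (Ioi 0)) := by
      by_contra h
      rw [integral_undef h] at hval
      have : 0 < 1 / α * Real.Gamma n := by positivity
      exact this.ne hval
    have hjm : Measurable (Function.uncurry fun (t : ℝ≥0∞) (s : ℝ) =>
        ENNReal.ofReal (s ^ (α * n - 1)) * expNeg (ENNReal.ofReal s * t)) := by
      refine Measurable.mul (by fun_prop) (continuous_expNeg.measurable.comp ?_)
      exact (ENNReal.measurable_ofReal.comp measurable_snd).mul measurable_fst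
    calc ENNReal.ofReal (Real.Gamma (α * n)) * ∫⁻ t, t ^ (-(α * n)) ∂P
        = ∫⁻ t, ENNReal.ofReal (Real.Gamma (α * n)) * t ^ (-(α * n)) ∂P :=
          (lintegral_const_mul' _ _ ENNReal.ofReal_ne_top).symm
      _ = ∫⁻ t, (∫⁻ s in Ioi (0 : ℝ),
            ENNReal.ofReal (s ^ (α * n - 1)) * expNeg (ENNReal.ofReal s * t)) ∂P := by
          refine lintegral_congr_ae ?_
          filter_upwards [compl_mem_ae_iff.2 hP0] with t ht
          exact (lintegral_rpow_mul_expNeg ha ht).symm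
      _ = ∫⁻ s in Ioi (0 : ℝ), (∫⁻ t,
            ENNReal.ofReal (s ^ (α * n - 1)) * expNeg (ENNReal.ofReal s * t) ∂P) :=
          lintegral_lintegral_swap hjm.aemeasurable
      _ = ∫⁻ s in Ioi (0 : ℝ), ENNReal.ofReal (s ^ (α * n - 1) * Real.exp (-s ^ α)) := by
          refine setLIntegral_congr_fun measurableSet_Ioi fun s hs => ?_
          have hs0 : (0 : ℝ) < s := hs
          rw [lintegral_const_mul' _ _ ENNReal.ofReal_ne_top, hL s hs,
            ENNReal.ofReal_mul (by positivity)]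
      _ = ENNReal.ofReal (1 / α * Real.Gamma n) := by
          rw [← hval, ofReal_integral_eq_lintegral_ofReal hint]
          filter_upwards [self_mem_ae_restrict measurableSet_Ioi] with s hs
          have hs0 : (0 : ℝ) < s := hs
          simp only [Pi.zero_apply]
          positivity
  have hpow : ∫⁻ t, ENNReal.ofReal ((t ^ (-α)).toReal ^ n) ∂P = ∫⁻ t, t ^ (-(α * n)) ∂P := by
    refine lintegral_congr_ae ?_
    filter_upwards [compl_mem_ae_iff.2 hP0] with t ht
    have htop : t ^ (-α) ≠ ⊤ := by
      intro h
      rcases ENNReal.rpow_eq_top_iff.1 h with h | h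
      · exact ht h.1
      · linarith [h.2]
    rw [ENNReal.ofReal_pow ENNReal.toReal_nonneg, ENNReal.ofReal_toReal htop,
      ← ENNReal.rpow_natCast, ← ENNReal.rpow_mul, neg_mul]
  rw [lintegral_map (by fun_prop) hmeas, hpow]
  have hΓ0 : ENNReal.ofReal (Real.Gamma (α * n)) ≠ 0 := by simpa using hΓ
  rw [← ENNReal.mul_right_inj hΓ0 ENNReal.ofReal_ne_top, hmom, ← ENNReal.ofReal_mul hΓ.le]
  congr 1
  have hfac : (n ! : ℝ) = n * Real.Gamma n := by
    rw [← Real.Gamma_nat_eq_factorial, Real.Gamma_add_one hn0.ne']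
  rw [hfac, Real.Gamma_add_one ha.ne']
  field_simp

end Stable

/-! ### The Mittag-Leffler function as a moment generating function -/

section MittagLeffler

open Set ProbabilityTheory

variable {α : ℝ}

/-- Only the part of the Gamma integral beyond `L` is kept, where `x ^ y ≥ L ^ y`. -/
theorem exp_neg_mul_rpow_le_Gamma {y L : ℝ} (hy : 0 ≤ y) (hL : 0 ≤ L) :
    Real.exp (-L) * L ^ y ≤ Real.Gamma (y + 1) := by
  have hint := Real.GammaIntegral_convergent (s := y + 1) (by linarith)
  rw [Real.Gamma_eq_integral (by linarith), ← integral_exp_neg_Ioi L, ← integral_mul_const]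
  simp only [add_sub_cancel_right] at hint ⊢
  have hsub : Ioi L ⊆ Ioi 0 := Ioi_subset_Ioi hL
  calc ∫ x in Ioi L, Real.exp (-x) * L ^ y ≤ ∫ x in Ioi L, Real.exp (-x) * x ^ y := by
        refine setIntegral_mono_on ((integrableOn_exp_neg_Ioi L).mul_const _)
          (hint.mono_set hsub) measurableSet_Ioi fun x hx => ?_
        exact mul_le_mul_of_nonneg_left (Real.rpow_le_rpow hL (le_of_lt hx) hy) (Real.exp_pos _).le
    _ ≤ ∫ x in Ioi 0, Real.exp (-x) * x ^ y := by
        refine setIntegral_mono_set hint ?_ hsub.eventuallyLE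
        filter_upwards [self_mem_ae_restrict measurableSet_Ioi] with x hx
        exact mul_nonneg (Real.exp_pos _).le (Real.rpow_nonneg (le_of_lt hx) _)

theorem Gamma_mul_nat_add_one_pos (hα : 0 < α) (n : ℕ) : 0 < Real.Gamma (α * n + 1) :=
  Real.Gamma_pos_of_pos (by positivity)

/-- In the Gamma lower bound `L` is free; choosing `L ^ α = 2|x| + 1` dominates the series by a
geometric one of ratio `1/2`. -/
theorem summable_mittagLeffler (hα : 0 < α) (x : ℝ) :
    Summable fun n : ℕ => x ^ n / Real.Gamma (α * n + 1) := by
  set L : ℝ := (2 * |x| + 1) ^ α⁻¹ with hLdef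
  have hL : 0 < L := by positivity
  have hLα : L ^ α = 2 * |x| + 1 := by
    rw [hLdef, ← Real.rpow_mul (by positivity), inv_mul_cancel₀ hα.ne', Real.rpow_one]
  refine Summable.of_norm_bounded (g := fun n : ℕ => Real.exp L * (1 / 2) ^ n)
    (summable_geometric_two.mul_left _) fun n => ?_
  have hΓ := exp_neg_mul_rpow_le_Gamma (y := α * n) (L := L) (by positivity) hL.le
  rw [Real.rpow_mul hL.le, hLα, Real.rpow_natCast] at hΓ
  have hpos : 0 < Real.exp (-L) * (2 * |x| + 1) ^ n := by positivity
  rw [norm_div, norm_pow, Real.norm_eq_abs,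
    Real.norm_of_nonneg (Gamma_mul_nat_add_one_pos hα n).le]
  calc |x| ^ n / Real.Gamma (α * n + 1) ≤ |x| ^ n / (Real.exp (-L) * (2 * |x| + 1) ^ n) := by
        gcongr
    _ = Real.exp L * (|x| / (2 * |x| + 1)) ^ n := by
        rw [Real.exp_neg, div_pow]
        field_simp
    _ ≤ Real.exp L * (1 / 2) ^ n := by
        refine mul_le_mul_of_nonneg_left (pow_le_pow_left₀ (by positivity) ?_ n) (Real.exp_pos L).le
        rw [div_le_div_iff₀ (by positivity) two_pos]
        linarith [abs_nonneg x]

theorem tsum_ofReal_inv_Gamma_mul_pow (hα : 0 < α) {c : ℝ} (hc : 0 ≤ c) :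
    ∑' n : ℕ, ENNReal.ofReal (1 / Real.Gamma (α * n + 1)) * ENNReal.ofReal c ^ n =
      ENNReal.ofReal (mittagLeffler α c) := by
  have hΓ := Gamma_mul_nat_add_one_pos hα
  rw [mittagLeffler, ENNReal.ofReal_tsum_of_nonneg
    (fun n => div_nonneg (pow_nonneg hc n) (hΓ n).le) (summable_mittagLeffler hα c)]
  refine tsum_congr fun n => ?_
  rw [← ENNReal.ofReal_pow hc, ← ENNReal.ofReal_mul (one_div_nonneg.2 (hΓ n).le)]
  congr 1
  ring

namespace IsMittagLefflerLaw

variable {ν : Measure ℝ} (hν : IsMittagLefflerLaw α ν)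
include hν

theorem integrable_pow (n : ℕ) : Integrable (fun t : ℝ => t ^ n) ν := by
  refine (lintegral_ofReal_ne_top_iff_integrable (by fun_prop) ?_).1 ?_
  · filter_upwards [hν.ae_nonneg] with t ht using pow_nonneg ht n
  · rw [hν.lintegral_pow]
    exact ENNReal.ofReal_ne_top

theorem integral_pow (hα : 0 < α) (n : ℕ) :
    ∫ t, t ^ n ∂ν = (n ! : ℝ) / Real.Gamma (α * n + 1) := by
  rw [integral_eq_lintegral_of_nonneg_ae _ (by fun_prop), hν.lintegral_pow,
    ENNReal.toReal_ofReal (div_nonneg (by positivity) (Gamma_mul_nat_add_one_pos hα n).le)]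
  filter_upwards [hν.ae_nonneg] with t ht using pow_nonneg ht n

theorem lintegral_exp_of_nonneg (hα : 0 < α) {c : ℝ} (hc : 0 ≤ c) :
    ∫⁻ t, ENNReal.ofReal (Real.exp (c * t)) ∂ν = ENNReal.ofReal (mittagLeffler α c) := by
  have : ∀ᵐ t ∂ν, ENNReal.ofReal (Real.exp (c * t)) =
      ∑' n : ℕ, ENNReal.ofReal (1 / n !) * ENNReal.ofReal c ^ n * ENNReal.ofReal (t ^ n) := by
    filter_upwards [hν.ae_nonneg] with t ht
    rw [← one_mul (Real.exp _),
      ← tsum_ofReal_div_factorial_mul_pow zero_le_one (mul_nonneg hc ht)]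
    refine tsum_congr fun n => ?_
    rw [ENNReal.ofReal_mul hc, mul_pow, ENNReal.ofReal_pow ht, mul_assoc]
  rw [lintegral_congr_ae this, lintegral_tsum (fun n => by fun_prop),
    ← tsum_ofReal_inv_Gamma_mul_pow hα hc]
  refine tsum_congr fun n => ?_
  rw [lintegral_const_mul' _ _ (by finiteness), hν.lintegral_pow, mul_right_comm,
    ← ENNReal.ofReal_mul (by positivity)]
  congr 2
  field_simp

theorem integrable_exp (hα : 0 < α) (x : ℝ) : Integrable (fun t => Real.exp (x * t)) ν := by
  have h : Integrable (fun t => Real.exp (|x| * t)) ν := by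
    refine (lintegral_ofReal_ne_top_iff_integrable (by fun_prop)
      (ae_of_all _ fun t => (Real.exp_pos _).le)).1 ?_
    rw [hν.lintegral_exp_of_nonneg hα (abs_nonneg x)]
    exact ENNReal.ofReal_ne_top
  refine h.mono' (by fun_prop) ?_
  filter_upwards [hν.ae_nonneg] with t ht
  rw [Real.norm_of_nonneg (Real.exp_pos _).le]
  exact Real.exp_le_exp.2 (mul_le_mul_of_nonneg_right (le_abs_self x) ht)

theorem mem_interior_integrableExpSet (hα : 0 < α) (x : ℝ) :
    x ∈ interior (integrableExpSet id ν) := by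
  have : integrableExpSet id ν = univ := eq_univ_of_forall fun y => hν.integrable_exp hα y
  simp [this]

/-- The exponential is integrated termwise; the integrals of the absolute values sum to `E_α(|x|)`,
which converges. -/
theorem mgf_eq (hα : 0 < α) : mgf id ν = mittagLeffler α := by
  ext x
  have hΓ := Gamma_mul_nat_add_one_pos hα
  have hF : ∀ (n : ℕ) (t : ℝ), x ^ n * t ^ n / (n ! : ℝ) = x ^ n / (n ! : ℝ) * t ^ n :=
    fun n t => by ring
  have h := hasSum_integral_of_summable_integral_norm (μ := ν)
    (F := fun (n : ℕ) (t : ℝ) => x ^ n / (n ! : ℝ) * t ^ n)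
    (fun n => (hν.integrable_pow n).const_mul _) (by
      refine (summable_mittagLeffler hα |x|).congr fun n => ?_
      have : ∫ t, ‖x ^ n / (n ! : ℝ) * t ^ n‖ ∂ν = ∫ t, |x| ^ n / (n ! : ℝ) * t ^ n ∂ν := by
        refine integral_congr_ae ?_
        filter_upwards [hν.ae_nonneg] with t ht
        rw [norm_mul, norm_div, norm_pow, Real.norm_eq_abs, Real.norm_of_nonneg (pow_nonneg ht n),
          Real.norm_of_nonneg (by positivity)]
      rw [this, integral_const_mul, hν.integral_pow hα]
      have := (hΓ n).ne'
      field_simp)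
  rw [mgf, mittagLeffler]
  have hexp : ∀ t : ℝ, ∑' n : ℕ, x ^ n / (n ! : ℝ) * t ^ n = Real.exp (x * id t) := by
    intro t
    rw [Real.exp_eq_exp_ℝ, ← (NormedSpace.expSeries_div_hasSum_exp (x * id t)).tsum_eq]
    refine tsum_congr fun n => ?_
    rw [id, mul_pow, hF]
  simp_rw [hexp] at h
  rw [← h.tsum_eq]
  refine tsum_congr fun n => ?_
  rw [integral_const_mul, hν.integral_pow hα]
  have := (hΓ n).ne'
  field_simp

/-- Exponential moments of every order allow differentiation under the integral. As the law lives on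
`[0, ∞)`, all derivatives are nonnegative, so `ENNReal.ofReal` does not truncate the coefficients.
-/
theorem iteratedDeriv_eq (hα : 0 < α) (n : ℕ) (x : ℝ) :
    iteratedDeriv n (mittagLeffler α) x = ∫ t, t ^ n * Real.exp (x * t) ∂ν := by
  rw [← hν.mgf_eq hα, iteratedDeriv_mgf (hν.mem_interior_integrableExpSet hα x)]
  rfl

theorem ofReal_iteratedDeriv (hα : 0 < α) (n : ℕ) (x : ℝ) :
    ENNReal.ofReal (iteratedDeriv n (mittagLeffler α) x / (n ! : ℝ)) =
      ∫⁻ t, ENNReal.ofReal (t ^ n * Real.exp (x * t) / (n ! : ℝ)) ∂ν := by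
  have hint : Integrable (fun t : ℝ => t ^ n * Real.exp (x * t)) ν :=
    integrable_pow_mul_exp_of_mem_interior_integrableExpSet
      (hν.mem_interior_integrableExpSet hα x) n
  rw [hν.iteratedDeriv_eq hα, ← integral_div, ofReal_integral_eq_lintegral_ofReal
    (hint.div_const _)]
  filter_upwards [hν.ae_nonneg] with t ht
  simp only [Pi.zero_apply]
  positivity

theorem lintegral_exp (hα : 0 < α) (x : ℝ) :
    ∫⁻ t, ENNReal.ofReal (Real.exp (x * t)) ∂ν = ENNReal.ofReal (mittagLeffler α x) := by
  rw [← hν.mgf_eq hα, mgf, ofReal_integral_eq_lintegral_ofReal (f := fun t => Real.exp (x * id t))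
    (hν.integrable_exp hα _) (ae_of_all _ fun t => (Real.exp_pos _).le)]
  rfl

/-- Taylor's formula for the Mittag-Leffler function; all its terms are nonnegative. -/
theorem tsum_iteratedDeriv (hα : 0 < α) (x : ℝ) {c : ℝ} (hc : 0 ≤ c) :
    ∑' n : ℕ, ENNReal.ofReal (iteratedDeriv n (mittagLeffler α) x / (n ! : ℝ)) *
      ENNReal.ofReal c ^ n = ENNReal.ofReal (mittagLeffler α (x + c)) := by
  have hE : ENNReal.ofReal (mittagLeffler α (x + c)) =
      ∫⁻ t, ENNReal.ofReal (Real.exp (x * t) * Real.exp (c * t)) ∂ν := by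
    rw [← hν.lintegral_exp hα]
    simp_rw [← Real.exp_add, add_mul]
  have : ∀ᵐ t ∂ν, ENNReal.ofReal (Real.exp (x * t) * Real.exp (c * t)) =
      ∑' n : ℕ, ENNReal.ofReal (t ^ n * Real.exp (x * t) / (n ! : ℝ)) * ENNReal.ofReal c ^ n := by
    filter_upwards [hν.ae_nonneg] with t ht
    rw [← tsum_ofReal_div_factorial_mul_pow (Real.exp_pos _).le (mul_nonneg hc ht)]
    refine tsum_congr fun n => ?_
    rw [ENNReal.ofReal_mul hc, mul_pow, mul_div_assoc, ENNReal.ofReal_mul (pow_nonneg ht n),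
      ENNReal.ofReal_pow ht]
    ring
  rw [hE, lintegral_congr_ae this, lintegral_tsum (fun n => by fun_prop)]
  refine tsum_congr fun n => ?_
  rw [hν.ofReal_iteratedDeriv hα, lintegral_mul_const' _ _ (by finiteness)]

theorem iteratedDeriv_zero (hα : 0 < α) (n : ℕ) :
    iteratedDeriv n (mittagLeffler α) 0 = (n ! : ℝ) / Real.Gamma (α * n + 1) := by
  rw [hν.iteratedDeriv_eq hα, ← hν.integral_pow hα]
  simp

end IsMittagLefflerLaw

end MittagLeffler

/-! ### Poisson and mixed Poisson processes on `M` -/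

section Gathering

variable {M : Type*} [TopologicalSpace M] [T2Space M] [LocallyCompactSpace M]
  [SecondCountableTopology M] [MeasurableSpace M] [BorelSpace M]

/-- The pieces of a partition of `M` into bounded Borel sets. -/
def piece (K : CompactExhaustion M) (k : ℕ) : Set M := disjointed (fun p => interior (K p)) k

theorem measurableSet_piece (K : CompactExhaustion M) (k : ℕ) : MeasurableSet (piece K k) :=
  MeasurableSet.disjointed (fun _ => isOpen_interior.measurableSet) k

theorem piece_subset (K : CompactExhaustion M) (k : ℕ) : piece K k ⊆ interior (K k) :=
  disjointed_le _ k

theorem pairwise_disjoint_piece (K : CompactExhaustion M) : Pairwise (Disjoint on piece K) :=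
  disjoint_disjointed _

theorem iUnion_piece (K : CompactExhaustion M) : ⋃ k, piece K k = Set.univ := by
  unfold piece
  rw [iUnion_disjointed, Set.eq_univ_iff_forall]
  intro x
  obtain ⟨p, hp⟩ := exists_subset_interior_compactExhaustion K (isCompact_singleton (x := x))
  exact Set.mem_iUnion.2 ⟨p, hp rfl⟩

theorem disjoint_interior_piece (K : CompactExhaustion M) {p k : ℕ} (h : p < k) :
    Disjoint (interior (K p)) (piece K k) := by
  have hmono : Monotone fun p => interior (K p) := fun a b hab => interior_mono (K.subset hab)
  obtain ⟨k, rfl⟩ : ∃ j, k = j + 1 := ⟨k - 1, by omega⟩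
  rw [piece, hmono.disjointed_add_one]
  exact (disjoint_sdiff_self_right).mono_left (hmono (Nat.lt_succ_iff.1 h))

/-- The configuration formed by the points of the `k`-th sample in the `k`-th piece. -/
def gather (K : CompactExhaustion M) (ω : ℕ → Σ n, (Fin n → M)) : Config M :=
  ⟨⋃ k, Set.range (ω k).2 ∩ piece K k, fun C hC => by
    obtain ⟨p, hp⟩ := exists_subset_interior_compactExhaustion K hC
    refine ((Set.finite_Iic p).biUnion fun k _ =>
      Set.finite_range (ω k).2).subset ?_
    rintro x ⟨hx, hxC⟩
    obtain ⟨k, hk, hxk⟩ := Set.mem_iUnion.1 hx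
    refine Set.mem_biUnion (x := k) ?_ hk
    by_contra hkp
    have hlt : p < k := not_le.1 hkp
    exact Set.disjoint_left.1 (disjoint_interior_piece K hlt) (hp hxC) hxk⟩

theorem mem_points_gather {K : CompactExhaustion M} {ω : ℕ → Σ n, (Fin n → M)} {x : M} :
    x ∈ (gather K ω).points ↔ ∃ k, x ∈ Set.range (ω k).2 ∧ x ∈ piece K k :=
  Set.mem_iUnion

theorem preimage_gather_avoiding (K : CompactExhaustion M) (B : Set M) :
    gather K ⁻¹' Config.avoiding B = {ω | ∀ k i, (ω k).2 i ∉ B ∩ piece K k} := by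
  ext ω
  rw [Set.mem_preimage, Config.mem_avoiding, Set.disjoint_left]
  constructor
  · rintro h k i ⟨hB, hk⟩
    exact h (mem_points_gather.2 ⟨k, ⟨i, rfl⟩, hk⟩) hB
  · intro h x hx hB
    obtain ⟨k, ⟨i, rfl⟩, hk⟩ := mem_points_gather.1 hx
    exact h k i ⟨hB, hk⟩

theorem measurable_gather (K : CompactExhaustion M) : Measurable (gather K) := by
  rw [Config.measurableSpace_eq]
  refine measurable_generateFrom ?_
  rintro _ ⟨B, hB, rfl⟩
  rw [preimage_gather_avoiding, Set.ofPred_forall]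
  refine .iInter fun k => ?_
  have : MeasurableSet {ω : Σ n, (Fin n → M) | ∀ i, ω.2 i ∉ B ∩ piece K k} := by
    refine MeasurableSpace.measurableSet_iInf.2 fun n => ?_
    change MeasurableSet {x : Fin n → M | ∀ i : Fin n, x i ∉ B ∩ piece K k}
    rw [Set.ofPred_forall]
    exact .iInter fun i => (measurable_pi_apply (X := fun _ : Fin n => M) i)
      (hB.measurableSet.inter (measurableSet_piece K k)).compl
  exact (measurable_pi_apply (X := fun _ : ℕ => Σ n, (Fin n → M)) k) this

theorem measure_lt_top_of_isBoundedBorel (μ : Measure M) [IsLocallyFiniteMeasure μ] {B : Set M}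
    (hB : IsBoundedBorel B) : μ B < ⊤ :=
  (measure_mono subset_closure).trans_lt hB.2.measure_lt_top

/-- The existence of the Poisson process, characterised by its void probabilities. -/
theorem exists_poissonProcess (μ : Measure M) [IsLocallyFiniteMeasure μ] :
    ∃ P : Measure (Config M), IsProbabilityMeasure P ∧
      ∀ B, IsBoundedBorel B → P (Config.avoiding B) = expNeg (μ B) := by
  have K : CompactExhaustion M := default
  let κ : ℕ → Measure M := fun k => μ.restrict (piece K k)
  have hκ : ∀ k, IsFiniteMeasure (κ k) := fun k => ⟨by
    rw [Measure.restrict_apply_univ]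
    exact (measure_mono (piece_subset K k)).trans_lt
      (measure_lt_top_of_isBoundedBorel μ (isBoundedBorel_interior K k))⟩
  refine ⟨(poissonSamples κ).map (gather K),
    Measure.isProbabilityMeasure_map (measurable_gather K).aemeasurable, fun B hB => ?_⟩
  have hm : ∀ k, MeasurableSet (B ∩ piece K k) :=
    fun k => hB.measurableSet.inter (measurableSet_piece K k)
  have hav := Config.measurableSet_avoiding hB
  let g : ℕ → M → ℝ≥0∞ := fun k => (B ∩ piece K k)ᶜ.indicator 1
  have hg : ∀ k, Measurable (g k) := fun k => measurable_one.indicator (hm k).compl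
  have hg1 : ∀ k x, g k x ≤ 1 := fun k x => Set.indicator_le_self' (by simp) x
  rw [Measure.map_apply (measurable_gather K) hav,
    ← lintegral_indicator_one (measurable_gather K hav),
    lintegral_poissonSamples_of_tendsto κ hg hg1]
  · congr 1
    have : ∀ k, ∫⁻ x, (1 - g k x) ∂(κ k) = μ (B ∩ piece K k) := by
      intro k
      have h1 : ∀ x, 1 - g k x = (B ∩ piece K k).indicator 1 x := by
        intro x
        by_cases hx : x ∈ B ∩ piece K k
        · simp only [g, Set.indicator_of_mem hx, Set.indicator_of_notMem (Set.notMem_compl_iff.2 hx),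
            Pi.one_apply, tsub_zero]
        · simp only [g, Set.indicator_of_notMem hx, Set.indicator_of_mem (Set.mem_compl hx),
            Pi.one_apply, tsub_self]
      simp_rw [h1]
      rw [lintegral_indicator_one (hm k), Measure.restrict_apply (hm k), Set.inter_assoc,
        Set.inter_self]
    simp_rw [this]
    rw [← measure_iUnion (fun i j hij => ((pairwise_disjoint_piece K) hij).mono
      Set.inter_subset_right Set.inter_subset_right) hm, ← Set.inter_iUnion, iUnion_piece,
      Set.inter_univ]
  · intro ω
    rw [preimage_gather_avoiding]
    by_cases h : ∀ k i, (ω k).2 i ∉ B ∩ piece K k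
    · rw [Set.indicator_of_mem (show ω ∈ {ω | ∀ k i, (ω k).2 i ∉ B ∩ piece K k} from h)]
      refine tendsto_const_nhds.congr fun n => ?_
      refine (Finset.prod_eq_one fun k _ => Finset.prod_eq_one fun i _ => ?_).symm
      exact Set.indicator_of_mem (Set.mem_compl (h k i)) _
    · rw [Set.indicator_of_notMem (show ω ∉ {ω | ∀ k i, (ω k).2 i ∉ B ∩ piece K k} from h)]
      push Not at h
      obtain ⟨k, i, hki⟩ := h
      -- Once the range includes a sample with a point in `B`, one factor is zero and the product
      -- stays zero.
      refine tendsto_const_nhds.congr' ?_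
      filter_upwards [eventually_gt_atTop k] with n hn
      refine (Finset.prod_eq_zero (Finset.mem_range.2 hn)
        (Finset.prod_eq_zero (Finset.mem_univ i) ?_)).symm
      exact Set.indicator_of_notMem (Set.notMem_compl_iff.2 hki) _

/-- The existence of the mixed Poisson process with a Mittag-Leffler mixing law. -/
theorem exists_measure_avoiding (μ : Measure M) [IsLocallyFiniteMeasure μ] {α : ℝ} (hα : 0 < α)
    {ν : Measure ℝ} (hν : IsMittagLefflerLaw α ν) :
    ∃ P : Measure (Config M), IsProbabilityMeasure P ∧ ∀ B, IsBoundedBorel B →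
      P (Config.avoiding B) = ENNReal.ofReal (mittagLeffler α (-(μ B).toReal)) := by
  have := hν.isProbabilityMeasure
  have hex : ∀ t : ℝ, ∃ Q : Measure (Config M), IsProbabilityMeasure Q ∧
      ∀ B, IsBoundedBorel B → Q (Config.avoiding B) = expNeg (ENNReal.ofReal t * μ B) :=
    -- Negative `t` yields the zero intensity, matching `ENNReal.ofReal t`; the mixing law does not
    -- charge such `t`.
    fun t => exists_poissonProcess (t.toNNReal • μ)
  choose Q hQ hQB using hex
  have hQm : Measurable Q := by
    refine Measurable.measure_of_isPiSystem_of_isProbabilityMeasure Config.measurableSpace_eq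
      Config.isPiSystem_avoidingEvents ?_
    rintro _ ⟨B, hB, rfl⟩
    simp_rw [hQB _ B hB]
    exact continuous_expNeg.measurable.comp (ENNReal.measurable_ofReal.mul_const _)
  refine ⟨ν.bind Q, ⟨?_⟩, fun B hB => ?_⟩
  · rw [Measure.bind_apply .univ hQm.aemeasurable]
    simp
  · rw [Measure.bind_apply (Config.measurableSet_avoiding hB) hQm.aemeasurable,
      ← hν.lintegral_exp hα]
    refine lintegral_congr_ae ?_
    filter_upwards [hν.ae_nonneg] with t ht
    rw [hQB t B hB, ← ENNReal.ofReal_toReal (measure_lt_top_of_isBoundedBorel μ hB).ne,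
      ← ENNReal.ofReal_mul ht, expNeg_ofReal (mul_nonneg ht ENNReal.toReal_nonneg),
      ENNReal.toReal_ofReal ENNReal.toReal_nonneg, neg_mul, mul_comm]

end Gathering

/-! ### The `n`-point measures and sums over subsets -/

section PointMeasure

variable {M : Type*} [TopologicalSpace M] [T2Space M] [LocallyCompactSpace M]
  [SecondCountableTopology M] [MeasurableSpace M] [BorelSpace M]

theorem measurable_sym (n : ℕ) : Measurable (sym (M := M) n) :=
  (FinConfig.continuous_sym n).measurable

theorem measurableSet_injective (n : ℕ) : MeasurableSet {x : Fin n → M | Injective x} := by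
  have : {x : Fin n → M | Injective x} = ⋂ i, ⋂ j, ⋂ (_ : i ≠ j), {x | x i = x j}ᶜ := by
    ext x
    simp only [Set.mem_iInter, Set.mem_compl_iff, Set.mem_ofPred_eq]
    exact ⟨fun h i j hij => h.ne hij, fun h i j hij => by_contra fun hne => h i j hne hij⟩
  rw [this]
  exact .iInter fun i => .iInter fun j => .iInter fun _ =>
    (measurableSet_eq_fun (measurable_pi_apply i) (measurable_pi_apply j)).compl

/-- Each diagonal is null by Fubini: its sections are single points, which have no mass. -/
theorem ae_injective (μ : Measure M) [SigmaFinite μ] [NullSingletonClass μ] (n : ℕ) :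
    ∀ᵐ x ∂(Measure.pi fun _ : Fin n => μ), Injective x := by
  have h : ∀ i j : Fin n, i ≠ j → ∀ᵐ x ∂(Measure.pi fun _ : Fin n => μ), x i ≠ x j := by
    intro i j hij
    obtain ⟨m, rfl⟩ : ∃ m, n = m + 1 := ⟨n - 1, by have := i.pos; omega⟩
    obtain ⟨j, rfl⟩ := Fin.exists_succAbove_eq hij.symm
    have hS : MeasurableSet {p : M × (Fin m → M) | p.1 = p.2 j} :=
      measurableSet_eq_fun measurable_fst ((measurable_pi_apply j).comp measurable_snd)
    have hnull : (μ.prod (Measure.pi fun _ : Fin m => μ)) {p | p.1 = p.2 j} = 0 := by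
      rw [Measure.prod_apply_symm hS]
      refine (lintegral_congr fun y => ?_).trans lintegral_zero
      have : (fun x => (x, y)) ⁻¹' {p : M × (Fin m → M) | p.1 = p.2 j} = {y j} := by
        ext; simp
      rw [this, measure_singleton]
    rw [← (measurePreserving_piFinSuccAbove (fun _ : Fin (m + 1) => μ) i).measure_preimage
      hS.nullMeasurableSet] at hnull
    filter_upwards [compl_mem_ae_iff.2 hnull] with x hx
    exact hx
  filter_upwards [ae_all_iff.2 fun i => ae_all_iff.2 fun j => ae_all_iff.2 (h i j)] with x hx
  exact fun i j hij => by_contra fun hne => hx i j hne hij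

theorem lintegral_pointMeasure (μ : Measure M) [SigmaFinite μ] [NullSingletonClass μ] (n : ℕ)
    {F : FinConfig M → ℝ≥0∞} (hF : Measurable F) {G : (Fin n → M) → ℝ≥0∞}
    (h : ∀ x : DistinctTuple M n, F (sym n x) = G x.1) :
    ∫⁻ η, F η ∂(pointMeasure μ n) = ∫⁻ x, G x ∂(Measure.pi fun _ : Fin n => μ) := by
  rw [pointMeasure, lintegral_map hF (measurable_sym n)]
  simp_rw [h]
  refine (lintegral_subtype_comap (measurableSet_injective n) G).trans ?_
  rw [Measure.restrict_eq_self_of_ae_mem (s := {x : Fin n → M | Injective x}) (ae_injective μ n)]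

theorem lintegral_prod_pointMeasure (μ : Measure M) [SigmaFinite μ] [NullSingletonClass μ] (n : ℕ)
    {g : M → ℝ≥0∞} (hg : Measurable g)
    (hF : Measurable fun η : FinConfig M => ∏ x ∈ η.points, g x) :
    ∫⁻ η, ∏ x ∈ η.points, g x ∂(pointMeasure μ n) = (∫⁻ x, g x ∂μ) ^ n := by
  rw [lintegral_pointMeasure μ n hF (G := fun x => ∏ i, g (x i)) fun x => FinConfig.prod_sym n x g,
    lintegral_pi_prod μ n hg]

theorem ae_card_pointMeasure (μ : Measure M) (n : ℕ) :
    ∀ᵐ η ∂(pointMeasure μ n), η.card = n :=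
  (ae_map_iff (measurable_sym n).aemeasurable
    (FinConfig.measurable_card (measurableSet_singleton n))).2
    (ae_of_all _ fun x => FinConfig.card_sym n x)

/-- The power of a restricted measure is the power restricted to a box, and tuples whose points form
an element of `A` already lie in that box. -/
theorem pointMeasure_restrict_apply (μ : Measure M) [SigmaFinite μ] (n : ℕ) {Λ : Set M}
    {A : Set (FinConfig M)} (hA : MeasurableSet A)
    (hAΛ : ∀ η ∈ A, (η.points : Set M) ⊆ Λ) :
    pointMeasure (μ.restrict Λ) n A = pointMeasure μ n A := by
  have hm : MeasurableSet (sym (M := M) n ⁻¹' A) := measurable_sym n hA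
  have he : MeasurableEmbedding (Subtype.val : DistinctTuple M n → (Fin n → M)) :=
    MeasurableEmbedding.subtype_coe (measurableSet_injective n)
  rw [pointMeasure, pointMeasure, Measure.map_apply (measurable_sym n) hA,
    Measure.map_apply (measurable_sym n) hA, he.comap_apply, he.comap_apply,
    ← Measure.restrict_pi_pi, Measure.restrict_apply (he.measurableSet_image.2 hm)]
  congr 1
  refine Set.inter_eq_left.2 ?_
  rintro _ ⟨x, hx, rfl⟩ i -
  refine hAΛ _ hx ?_
  rw [FinConfig.points_sym]
  exact Set.mem_range_self i

/-- The function `1 + 𝟙_{Bᶜ}`. -/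
def onePlus (B : Set M) (x : M) : ℝ≥0∞ := 1 + Bᶜ.indicator 1 x

theorem measurable_onePlus {B : Set M} (hB : MeasurableSet B) : Measurable (onePlus B) :=
  (measurable_const (a := (1 : ℝ≥0∞))).add (measurable_one.indicator hB.compl)

theorem prod_indicator_compl (B : Set M) (η : FinConfig M) :
    ∏ x ∈ η.points, Bᶜ.indicator (1 : M → ℝ≥0∞) x =
      (FinConfig.avoiding B).indicator (1 : FinConfig M → ℝ≥0∞) η := by
  by_cases h : Disjoint (η.points : Set M) B
  · rw [Set.indicator_of_mem (FinConfig.mem_avoiding.2 h)]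
    exact Finset.prod_eq_one fun x hx =>
      Set.indicator_of_mem (Set.mem_compl (Set.disjoint_left.1 h hx)) _
  · rw [Set.indicator_of_notMem (fun h' => h (FinConfig.mem_avoiding.1 h'))]
    obtain ⟨x, hx, hxB⟩ := Set.not_disjoint_iff.1 h
    exact Finset.prod_eq_zero (Finset.mem_coe.1 hx)
      (Set.indicator_of_notMem (Set.notMem_compl_iff.2 hxB) _)

theorem measurable_prod_indicator_compl {B : Set M} (hB : MeasurableSet B) :
    Measurable fun η : FinConfig M => ∏ x ∈ η.points, Bᶜ.indicator (1 : M → ℝ≥0∞) x := by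
  have : (fun η : FinConfig M => ∏ x ∈ η.points, Bᶜ.indicator (1 : M → ℝ≥0∞) x) =
      (FinConfig.avoiding B).indicator 1 := by
    ext η
    exact prod_indicator_compl B η
  rw [this]
  exact measurable_one.indicator (FinConfig.measurableSet_avoiding hB)

/-- Each point outside `B` contributes a factor `2` and the others `1`, so the product is a function
of a measurable count. -/
theorem measurable_prod_onePlus {B : Set M} (hB : MeasurableSet B) :
    Measurable fun η : FinConfig M => ∏ x ∈ η.points, onePlus B x := by
  classical
  have : (fun η : FinConfig M => ∏ x ∈ η.points, onePlus B x) =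
      fun η => (2 : ℝ≥0∞) ^ ((η.points : Set M) ∩ Bᶜ).encard.toNat := by
    ext η
    have hcard : ((η.points : Set M) ∩ Bᶜ).encard.toNat = (η.points.filter (· ∉ B)).card := by
      have : (η.points : Set M) ∩ Bᶜ = (η.points.filter (· ∉ B) : Finset M) := by
        ext; simp
      rw [this, Set.encard_coe_eq_coe_finsetCard]
      simp
    have hterm : ∀ x, onePlus B x = if x ∉ B then 2 else 1 := by
      intro x
      by_cases hx : x ∈ B <;> simp [onePlus, hx, one_add_one_eq_two]
    rw [hcard]
    simp_rw [hterm]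
    rw [Finset.prod_ite, Finset.prod_const, Finset.prod_const_one, mul_one]
  rw [this]
  exact (measurable_from_top (f := fun n : ℕ∞ => (2 : ℝ≥0∞) ^ n.toNat)).comp
    (FinConfig.measurable_encard_inter hB.compl)

/-- A finite set as a finite configuration. -/
def FinConfig.ofFinset (s : Finset M) : FinConfig M := s

/-- The subsets of a finite configuration. -/
def FinConfig.subsets (ζ : FinConfig M) : Finset (FinConfig M) :=
  ζ.points.powerset.map ⟨FinConfig.ofFinset, fun _ _ h => h⟩

theorem FinConfig.mem_subsets {η ζ : FinConfig M} :
    η ∈ ζ.subsets ↔ (η.points : Set M) ⊆ ζ.points := by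
  rw [Finset.coe_subset, ← Finset.mem_powerset]
  exact Finset.mem_map' (a := η.points) (s := ζ.points.powerset)
    ⟨FinConfig.ofFinset, fun _ _ h => h⟩

/-- The counting measure on the subsets of a finite configuration. -/
def subsetsMeasure (ζ : FinConfig M) : Measure (FinConfig M) :=
  ∑ η ∈ ζ.subsets, Measure.dirac η

theorem subsetsMeasure_apply (ζ : FinConfig M) {A : Set (FinConfig M)} (hA : MeasurableSet A) :
    subsetsMeasure ζ A = ∑ η ∈ ζ.subsets, A.indicator (1 : FinConfig M → ℝ≥0∞) η := by
  rw [subsetsMeasure, Measure.finsetSum_apply]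
  exact Finset.sum_congr rfl fun η _ => Measure.dirac_apply' _ hA

instance (ζ : FinConfig M) : IsFiniteMeasure (subsetsMeasure ζ) := ⟨by
  rw [subsetsMeasure_apply ζ .univ]
  simp⟩

/-- Expanding `∏ (1 + 𝟙_{Bᶜ})` gives one term per subset, equal to `1` if the subset misses `B` and
`0` otherwise. -/
theorem subsetsMeasure_avoiding (ζ : FinConfig M) {B : Set M} (hB : MeasurableSet B) :
    subsetsMeasure ζ (FinConfig.avoiding B) = ∏ x ∈ ζ.points, onePlus B x := by
  classical
  rw [subsetsMeasure_apply ζ (FinConfig.measurableSet_avoiding hB)]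
  simp_rw [onePlus]
  rw [Finset.prod_one_add, FinConfig.subsets, Finset.sum_map]
  exact Finset.sum_congr rfl fun s _ => (prod_indicator_compl B (FinConfig.ofFinset s)).symm

theorem measurable_subsetsMeasure : Measurable (subsetsMeasure (M := M)) := by
  have h : ∀ B : Set M, MeasurableSet B →
      Measurable fun ζ : FinConfig M => subsetsMeasure ζ (FinConfig.avoiding B) := by
    intro B hB
    simp_rw [subsetsMeasure_avoiding _ hB]
    exact measurable_prod_onePlus hB
  refine Measurable.measure_of_isPiSystem FinConfig.measurableSpace_eq
    FinConfig.isPiSystem_avoidingEvents ?_ ?_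
  · rintro _ ⟨B, hB, rfl⟩
    exact h B hB
  · have := h ∅ .empty
    simpa [FinConfig.avoiding] using this

end PointMeasure

/-! ### The local fractional Poisson measures -/

section Local

variable {M : Type*} [TopologicalSpace M] [T2Space M] [LocallyCompactSpace M]
  [SecondCountableTopology M] [MeasurableSpace M] [BorelSpace M] {α : ℝ} {ν : Measure ℝ}

/-- The `n`-point part integrates to `(∫_Λ g)ⁿ`, and the weights are the Taylor coefficients of
`E_α` at `-μ(Λ)`. -/
theorem lintegral_prod_localFracPoisson (μ : Measure M) [SigmaFinite μ] [NullSingletonClass μ]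
    (hα : 0 < α) (hν : IsMittagLefflerLaw α ν) (Λ : Set M) {g : M → ℝ≥0∞} (hg : Measurable g)
    (hF : Measurable fun η : FinConfig M => ∏ x ∈ η.points, g x)
    (hfin : ∫⁻ x in Λ, g x ∂μ ≠ ⊤) :
    ∫⁻ η, ∏ x ∈ η.points, g x ∂(localFracPoisson α μ Λ) =
      ENNReal.ofReal (mittagLeffler α (-(μ Λ).toReal + (∫⁻ x in Λ, g x ∂μ).toReal)) := by
  rw [localFracPoisson, lintegral_sum_measure]
  simp_rw [lintegral_smul_measure, smul_eq_mul, lintegral_prod_pointMeasure _ _ hg hF]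
  rw [← hν.tsum_iteratedDeriv hα _ ENNReal.toReal_nonneg, ENNReal.ofReal_toReal hfin]

theorem lintegral_indicator_compl (μ : Measure M) {B : Set M} (hB : MeasurableSet B) (Λ : Set M) :
    ∫⁻ x in Λ, Bᶜ.indicator 1 x ∂μ = μ (Bᶜ ∩ Λ) := by
  rw [lintegral_indicator_one hB.compl, Measure.restrict_apply hB.compl]

theorem localFracPoisson_avoiding (μ : Measure M) [SigmaFinite μ] [NullSingletonClass μ]
    (hα : 0 < α) (hν : IsMittagLefflerLaw α ν) {Λ : Set M} (hΛ : μ Λ ≠ ⊤) {B : Set M}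
    (hB : MeasurableSet B) :
    localFracPoisson α μ Λ (FinConfig.avoiding B) =
      ENNReal.ofReal (mittagLeffler α (-(μ (B ∩ Λ)).toReal)) := by
  have hint := lintegral_indicator_compl μ hB Λ
  have hfin : μ (Bᶜ ∩ Λ) ≠ ⊤ := measure_ne_top_of_subset Set.inter_subset_right hΛ
  have hfin' : μ (B ∩ Λ) ≠ ⊤ := measure_ne_top_of_subset Set.inter_subset_right hΛ
  have hadd : μ Λ = μ (B ∩ Λ) + μ (Bᶜ ∩ Λ) := by
    rw [← measure_inter_add_sdiff Λ hB, Set.inter_comm Λ, Set.sdiff_eq, Set.inter_comm Λ]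
  have h := lintegral_prod_localFracPoisson μ hα hν Λ (measurable_one.indicator hB.compl)
    (measurable_prod_indicator_compl hB) (by rwa [hint])
  rw [hint, hadd, ENNReal.toReal_add hfin' hfin, neg_add, neg_add_cancel_right] at h
  rw [← h, ← lintegral_indicator_one (FinConfig.measurableSet_avoiding hB)]
  exact lintegral_congr fun η => (prod_indicator_compl B η).symm

theorem lintegral_onePlus (μ : Measure M) {B : Set M} (hB : MeasurableSet B) (Λ : Set M) :
    ∫⁻ x in Λ, onePlus B x ∂μ = μ Λ + μ (Bᶜ ∩ Λ) := by
  simp_rw [onePlus]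
  rw [lintegral_add_left measurable_const, lintegral_indicator_compl μ hB]
  simp

theorem fracLebesguePoisson_avoiding (μ : Measure M) [SigmaFinite μ] [NullSingletonClass μ]
    (hα : 0 < α) {B : Set M} (hB : MeasurableSet B) (hfin : μ Bᶜ ≠ ⊤) :
    fracLebesguePoisson α μ (FinConfig.avoiding B) =
      ENNReal.ofReal (mittagLeffler α (μ Bᶜ).toReal) := by
  have hn : ∀ n, pointMeasure μ n (FinConfig.avoiding B) = μ Bᶜ ^ n := by
    intro n
    have h := lintegral_prod_pointMeasure μ n (measurable_one.indicator hB.compl)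
      (measurable_prod_indicator_compl hB)
    rw [lintegral_indicator_one hB.compl] at h
    rw [← h, ← lintegral_indicator_one (FinConfig.measurableSet_avoiding hB)]
    exact lintegral_congr fun η => (prod_indicator_compl B η).symm
  rw [fracLebesguePoisson, Measure.sum_apply _ (FinConfig.measurableSet_avoiding hB)]
  simp_rw [Measure.smul_apply, smul_eq_mul, hn]
  rw [← tsum_ofReal_inv_Gamma_mul_pow hα ENNReal.toReal_nonneg, ENNReal.ofReal_toReal hfin]

/-- The `K`-transform carries the local fractional Poisson measure over to the fractional
Lebesgue-Poisson measure. -/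
theorem bind_subsetsMeasure (μ : Measure M) [SigmaFinite μ] [NullSingletonClass μ]
    (hα : 0 < α) (hν : IsMittagLefflerLaw α ν) {Λ : Set M} (hΛ : μ Λ ≠ ⊤) :
    (localFracPoisson α μ Λ).bind subsetsMeasure = fracLebesguePoisson α (μ.restrict Λ) := by
  have hval : ∀ B : Set M, MeasurableSet B →
      (localFracPoisson α μ Λ).bind subsetsMeasure (FinConfig.avoiding B) =
        ENNReal.ofReal (mittagLeffler α (μ (Bᶜ ∩ Λ)).toReal) := by
    intro B hB
    have hfin : μ (Bᶜ ∩ Λ) ≠ ⊤ := measure_ne_top_of_subset Set.inter_subset_right hΛ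
    rw [Measure.bind_apply (FinConfig.measurableSet_avoiding hB)
      measurable_subsetsMeasure.aemeasurable]
    simp_rw [subsetsMeasure_avoiding _ hB]
    have hint := lintegral_onePlus μ hB Λ
    -- Here `∫_Λ g = μ(Λ) + μ(Bᶜ ∩ Λ)`, and the first term cancels the base point `-μ(Λ)` of the
    -- Taylor series.
    rw [lintegral_prod_localFracPoisson μ hα hν Λ (measurable_onePlus hB)
      (measurable_prod_onePlus hB) (by rw [hint]; finiteness), hint,
      ENNReal.toReal_add hΛ hfin, neg_add_cancel_left]
  have : IsFiniteMeasure ((localFracPoisson α μ Λ).bind subsetsMeasure) := ⟨by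
    have h := hval ∅ .empty
    have huniv : FinConfig.avoiding (∅ : Set M) = Set.univ := by
      simp [FinConfig.avoiding]
    rw [huniv] at h
    rw [h]
    exact ENNReal.ofReal_lt_top⟩
  refine FinConfig.measure_ext fun B hB => ?_
  rw [hval B hB, fracLebesguePoisson_avoiding _ hα hB, Measure.restrict_apply hB.compl]
  rw [Measure.restrict_apply hB.compl]
  exact measure_ne_top_of_subset Set.inter_subset_right hΛ

theorem fracLebesguePoisson_restrict_apply (μ : Measure M) [SigmaFinite μ] {Λ : Set M}
    {A : Set (FinConfig M)} (hA : MeasurableSet A)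
    (hAΛ : ∀ η ∈ A, (η.points : Set M) ⊆ Λ) :
    fracLebesguePoisson α (μ.restrict Λ) A = fracLebesguePoisson α μ A := by
  simp_rw [fracLebesguePoisson, Measure.sum_apply _ hA, Measure.smul_apply,
    pointMeasure_restrict_apply μ _ hA hAΛ]

/-- Since `kᵖ ≤ p! eᵏ`, the moments are dominated by the product functional of the constant `g = e`.
-/
theorem lintegral_card_pow_localFracPoisson_lt_top (μ : Measure M) [SigmaFinite μ]
    [NullSingletonClass μ] (hα : 0 < α) (hν : IsMittagLefflerLaw α ν) {Λ : Set M} (hΛ : μ Λ ≠ ⊤)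
    (p : ℕ) : ∫⁻ η, (η.card : ℝ≥0∞) ^ p ∂(localFracPoisson α μ Λ) < ⊤ := by
  have hle : ∀ η : FinConfig M, (η.card : ℝ≥0∞) ^ p ≤
      ENNReal.ofReal (p ! : ℝ) * ∏ _x ∈ η.points, ENNReal.ofReal (Real.exp 1) := by
    intro η
    rw [Finset.prod_const, ← ENNReal.ofReal_pow (Real.exp_pos 1).le, ← Real.exp_nat_mul, mul_one,
      ← ENNReal.ofReal_mul (by positivity), ← ENNReal.ofReal_natCast,
      ← ENNReal.ofReal_pow (by positivity)]
    refine ENNReal.ofReal_le_ofReal ?_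
    have := Real.pow_div_factorial_le_exp (η.card : ℝ) (by positivity) p
    rw [div_le_iff₀ (by positivity)] at this
    rw [mul_comm]
    exact this
  refine (lintegral_mono hle).trans_lt ?_
  have hF : Measurable fun η : FinConfig M =>
      ∏ _x ∈ η.points, ENNReal.ofReal (Real.exp 1) := by
    simp_rw [Finset.prod_const]
    exact (measurable_from_top (f := fun n : ℕ => ENNReal.ofReal (Real.exp 1) ^ n)).comp
      FinConfig.measurable_card
  rw [lintegral_const_mul _ hF, lintegral_prod_localFracPoisson μ hα hν Λ measurable_const hF]
  · finiteness
  · rw [lintegral_const, Measure.restrict_apply_univ]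
    finiteness

end Local

/-! ### The `K`-transform and correlation measures -/

section KTransform

variable {M : Type*} [TopologicalSpace M] [T2Space M] [LocallyCompactSpace M]
  [SecondCountableTopology M] [MeasurableSpace M] [BorelSpace M]

/-- Elements of `A` lie in `Λ`, so only subsets of `γ ∩ Λ` contribute; this turns the correlation
identity into one about the local measure. -/
theorem ofReal_kTransform_indicator {Λ : Set M} (hΛ : IsCompact (closure Λ))
    {A : Set (FinConfig M)} (hA : MeasurableSet A) (hAΛ : ∀ η ∈ A, (η.points : Set M) ⊆ Λ)
    (γ : Config M) :
    ENNReal.ofReal (kTransform (A.indicator fun _ => (1 : ℝ)) γ) =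
      subsetsMeasure (proj Λ hΛ γ) A := by
  have hsum : kTransform (A.indicator fun _ => (1 : ℝ)) γ =
      ∑ η ∈ (proj Λ hΛ γ).subsets, A.indicator (fun _ => (1 : ℝ)) η := by
    refine finsum_mem_eq_sum_of_inter_support_eq _ ?_
    ext η
    refine and_congr_left fun hη => ?_
    have hηA : η ∈ A := by
      by_contra h
      exact hη (Set.indicator_of_notMem h _)
    rw [Finset.mem_coe, FinConfig.mem_subsets, coe_points_proj, Set.subset_inter_iff]
    exact ⟨fun h => ⟨h, hAΛ η hηA⟩, fun h => h.1⟩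
  rw [hsum, subsetsMeasure_apply _ hA, ENNReal.ofReal_sum_of_nonneg fun η _ =>
    Set.indicator_nonneg (fun _ _ => zero_le_one) _]
  refine Finset.sum_congr rfl fun η _ => ?_
  by_cases h : η ∈ A
  · simp [h]
  · simp [h]

/-- Measures on `Γ₀` are determined by their values on bounded measurable sets. -/
theorem FinConfig.measure_ext_of_isBoundedConfigSet {P Q : Measure (FinConfig M)}
    (h : ∀ A, MeasurableSet A → IsBoundedConfigSet A → P A = Q A) : P = Q := by
  have K : CompactExhaustion M := default
  let S : ℕ → Set (FinConfig M) := fun p =>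
    FinConfig.card ⁻¹' Set.Iic p ∩ FinConfig.avoiding (interior (K p))ᶜ
  have hSm : ∀ p, MeasurableSet (S p) := fun p =>
    (FinConfig.measurable_card measurableSet_Iic).inter
      (FinConfig.measurableSet_avoiding isOpen_interior.measurableSet.compl)
  have hmem : ∀ p η, η ∈ S p ↔ η.card ≤ p ∧ (η.points : Set M) ⊆ interior (K p) := by
    intro p η
    refine and_congr Iff.rfl ?_
    rw [FinConfig.mem_avoiding, Set.disjoint_compl_right_iff_subset]
  have hmono : Monotone S := by
    intro p q hpq η hη
    rw [hmem] at hη ⊢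
    exact ⟨hη.1.trans hpq, hη.2.trans (interior_mono (K.subset hpq))⟩
  have hunion : ⋃ p, S p = Set.univ := by
    refine Set.eq_univ_of_forall fun η => ?_
    obtain ⟨p, hp⟩ := exists_subset_interior_compactExhaustion K η.points.finite_toSet.isCompact
    refine Set.mem_iUnion.2 ⟨max η.card p, (hmem _ _).2 ⟨le_max_left _ _,
      hp.trans (interior_mono (K.subset (le_max_right _ _)))⟩⟩
  have hA : ∀ A : Set (FinConfig M), A = ⋃ p, A ∩ S p := fun A => by
    rw [← Set.inter_iUnion, hunion, Set.inter_univ]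
  ext A hAm
  have hAmono : Monotone fun p => A ∩ S p := fun p q hpq => Set.inter_subset_inter_right _ (hmono hpq)
  rw [hA A, hAmono.measure_iUnion, hAmono.measure_iUnion]
  refine iSup_congr fun p => h _ (hAm.inter (hSm p)) ⟨p, interior (K p),
    isBoundedBorel_interior K p, fun η hη => (hmem p η).1 hη.2⟩

/-- On the `n`-point part the density is the constant `n!/Γ(αn+1)`, whose factorial cancels the
weight `1/n!`. -/
theorem fracLebesguePoisson_eq_withDensity (μ : Measure M) {α : ℝ} (hα : 0 < α) {ν : Measure ℝ}
    (hν : IsMittagLefflerLaw α ν) :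
    fracLebesguePoisson α μ = (lebesguePoisson μ).withDensity fun η =>
      ENNReal.ofReal (iteratedDeriv η.card (mittagLeffler α) 0) := by
  rw [lebesguePoisson, withDensity_sum, fracLebesguePoisson]
  congr 1
  ext1 n
  have : (fun η : FinConfig M => ENNReal.ofReal (iteratedDeriv η.card (mittagLeffler α) 0))
      =ᵐ[pointMeasure μ n] fun _ => ENNReal.ofReal ((n ! : ℝ) / Real.Gamma (α * n + 1)) := by
    filter_upwards [ae_card_pointMeasure μ n] with η hη
    rw [hη, hν.iteratedDeriv_zero hα]
  rw [withDensity_smul_measure, withDensity_congr_ae this, withDensity_const, smul_smul,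
    ← ENNReal.ofReal_mul (by positivity)]
  congr 2
  field_simp

end KTransform

end FracPoisson

end

/-! ### The main theorem -/

theorem theorem2 {M : Type*} [TopologicalSpace M] [T2Space M] [LocallyCompactSpace M]
    [SecondCountableTopology M] [MeasurableSpace M] [BorelSpace M]
    (μ : Measure M) [IsLocallyFiniteMeasure μ] [NullSingletonClass μ]
    (α : ℝ) (hα0 : 0 < α) (hα1 : α < 1) :
    ∃ π : Measure (FracPoisson.Config M),
      -- `π` is the one and only fractional Poisson measure, and it is a probability measure
      (∀ ν : Measure (FracPoisson.Config M), FracPoisson.IsFracPoisson α μ ν ↔ ν = π) ∧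
      IsProbabilityMeasure π ∧
      FracPoisson.HasFiniteLocalMoments π ∧
      -- its correlation measure exists, is unique, and is the fractional Lebesgue-Poisson measure
      (∀ ρ : Measure (FracPoisson.FinConfig M),
        FracPoisson.IsCorrelationMeasure π ρ ↔ ρ = FracPoisson.fracLebesguePoisson α μ) ∧
      FracPoisson.fracLebesguePoisson α μ =
        (FracPoisson.lebesguePoisson μ).withDensity fun η =>
          ENNReal.ofReal (iteratedDeriv η.card (FracPoisson.mittagLeffler α) 0) := by
  open FracPoisson in
  obtain ⟨m, hm⟩ := exists_isMittagLefflerLaw hα0 hα1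
  obtain ⟨π, hπ, hπB⟩ := exists_measure_avoiding μ hα0 hm
  have hfin : ∀ {Λ : Set M}, IsBoundedBorel Λ → μ Λ ≠ ⊤ :=
    fun hΛ => (measure_lt_top_of_isBoundedBorel μ hΛ).ne
  have hπF : IsFracPoisson α μ π := by
    intro Λ hΛ
    have := Measure.isProbabilityMeasure_map (μ := π) (measurable_proj hΛ).aemeasurable
    refine FinConfig.measure_ext fun B hB => ?_
    rw [Measure.map_apply (measurable_proj hΛ) (FinConfig.measurableSet_avoiding hB),
      preimage_proj_avoiding, hπB _ (isBoundedBorel_inter hB hΛ),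
      localFracPoisson_avoiding μ hα0 hm (hfin hΛ) hB]
  have hcorr : IsCorrelationMeasure π (fracLebesguePoisson α μ) := by
    rintro A hA ⟨N, Λ, hΛ, hAN⟩
    have hAΛ : ∀ η ∈ A, (η.points : Set M) ⊆ Λ := fun η hη => (hAN η hη).2
    simp_rw [ofReal_kTransform_indicator hΛ.isCompact_closure hA hAΛ]
    rw [← fracLebesguePoisson_restrict_apply μ hA hAΛ, ← bind_subsetsMeasure μ hα0 hm (hfin hΛ),
      Measure.bind_apply hA measurable_subsetsMeasure.aemeasurable, ← hπF Λ hΛ]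
    exact lintegral_map ((Measure.measurable_coe hA).comp measurable_subsetsMeasure)
      (measurable_proj hΛ)
  refine ⟨π, fun ν => ⟨fun hν => ?_, fun h => h ▸ hπF⟩, hπ, fun n Λ hΛ => ?_,
    fun ρ => ⟨fun hρ => ?_, fun h => h ▸ hcorr⟩, fracLebesguePoisson_eq_withDensity μ hα0 hm⟩
  · refine (Config.measure_ext fun B hB => ?_).symm
    -- Avoiding `B` means that the projection to `B` is empty, so the local laws fix all void
    -- probabilities.
    have hBB : Config.avoiding B =
        proj B hB.isCompact_closure ⁻¹' FinConfig.avoiding Set.univ := by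
      rw [preimage_proj_avoiding, Set.univ_inter]
    have hm' := FinConfig.measurableSet_avoiding (M := M) .univ
    rw [hBB, ← Measure.map_apply (measurable_proj hB) hm',
      ← Measure.map_apply (measurable_proj hB) hm', hπF B hB, hν B hB]
  · have h := lintegral_card_pow_localFracPoisson_lt_top μ hα0 hm (hfin hΛ) n
    rw [← hπF Λ hΛ] at h
    exact (lintegral_map ((measurable_from_top (f := fun k : ℕ => (k : ℝ≥0∞) ^ n)).comp
      FinConfig.measurable_card) (measurable_proj hΛ)).symm.trans_lt h
  · refine FinConfig.measure_ext_of_isBoundedConfigSet fun A hA hAb => ?_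
    rw [hρ A hA hAb, hcorr A hA hAb]
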